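/- Let $\Omega\subset\mathbb C^n$ be a bounded domain, let $L^2_h(\Omega)$ be the Hilbert space of square-integrable holomorphic functions on $\Omega$ with $\langle f,g\rangle=\int_\Omega f\bar g\,d\lambda$ ($\lambda$ Lebesgue measure), let $K(z)=K(z,z)$ be its Bergman kernel on the diagonal, and let $T_{i\bar j}=\frac{\partial^2}{\partial z_i\partial\bar z_j}\log K$ be the Bergman metric and $\mathrm{Ric}_{i\bar j}=-\frac{\partial^2}{\partial z_i\partial\bar z_j}\log\det(T_{p\bar q})$ its Ricci tensor. Put $$\tilde T_{i\bar j}=(n+1)T_{i\bar j}-\mathrm{Ric}_{i\bar j}.$$ Let $\widetilde{\mathrm{dist}}_\Omega(z,\zeta)$ be the infimum of $\int_0^1\big(\sum_{i,j}\tilde T_{i\bar j}(\gamma(t))\gamma_i'(t)\overline{\gamma_j'(t)}\big)^{1/2}dt$ over all continuous piecewise $C^1$ curves $\gamma:[0,1]\to\Omega$ with $\gamma(0)=z$, $\gamma(1)=\zeta$. Suppose that for all linearly independent $f_0,\dots,f_n\in L^2_h(\Omega)$, every boundary point $z_0\in\partial\Omega$ and every sequence $(z_s)_{s\ge1}$ in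 $\Omega$ with $z_s\to z_0$ in the Euclidean topology, there is a subsequence $(z_{s_k})$ along which the following limit exists and satisfies $$\lim_{k\to\infty}\left.\frac{\left|\det\begin{pmatrix} f_0&\cdots&f_n\\ \frac{\partial f_0}{\partial z_1}&\cdots&\frac{\partial f_n}{\partial z_1}\\ \vdots&\ddots&\vdots\\ \frac{\partial f_0}{\partial z_n}&\cdots&\frac{\partial f_n}{\partial z_n}\end{pmatrix}\right|^2}{K^{n+1}\det\left(\frac{\partial^2}{\partial z_i\partial\bar z_j}\log K\right)}\right|_{z=z_{s_k}}<\det\begin{pmatrix}\langle f_0,f_0\rangle&\cdots&\langle f_n,f_0\rangle\\ \vdots&\ddots&\vdots\\ \langle f_0,f_n\rangle&\cdots&\langle f_n,f_n\rangle\end{pmatrix}.$$ Then $\tilde T$ is complete: every sequence in $\Omega$ that is Cauchy with respect to $\widetilde{\mathrm{dist}}_\Omega$ converges with respect to $\widetilde{\mathrm{dist}}_\Omega$ to a point of $\Omega$. -/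

import Mathlib

open MeasureTheory Set Filter Topology

noncomputable section

namespace BergmanRicci

variable {n : ℕ}

/-! Points of `ℂⁿ` are functions `Fin n → ℂ`, with Lebesgue measure `volume`. The norm of this space
is only used through the topology and the bounded sets, which are the Euclidean ones. -/

/-- The square-integrable holomorphic functions on `Ω` (only the values on `Ω` matter). -/
def IsL2Holomorphic (Ω : Set (Fin n → ℂ)) (f : (Fin n → ℂ) → ℂ) : Prop :=
  DifferentiableOn ℂ f Ω ∧ MemLp f 2 (volume.restrict Ω)

/-- The inner product `⟨f, g⟩ = ∫_Ω f ḡ dλ`, linear in the first argument. -/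
def l2Inner (Ω : Set (Fin n → ℂ)) (f g : (Fin n → ℂ) → ℂ) : ℂ :=
  ∫ z in Ω, f z * starRingEnd ℂ (g z)

/-- `k` represents the evaluation at `w` on the space of square-integrable holomorphic functions. -/
def IsReproducingAt (Ω : Set (Fin n → ℂ)) (w : Fin n → ℂ) (k : (Fin n → ℂ) → ℂ) : Prop :=
  IsL2Holomorphic Ω k ∧ ∀ f, IsL2Holomorphic Ω f → f w = l2Inner Ω f k

open Classical in
/-- The Bergman kernel `K(z, w)` of `Ω`: for `w ∈ Ω`, `K(·, w)` is the square-integrable holomorphic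
function representing the evaluation at `w`; it is unique as a function on `Ω`, and it exists
by the Riesz theorem. -/
def bergmanKernel (Ω : Set (Fin n → ℂ)) (z w : Fin n → ℂ) : ℂ :=
  if h : ∃ k, IsReproducingAt Ω w k then h.choose z else 0

/-- The Bergman kernel on the diagonal, which is real since `K(z, z) = ‖K(·, z)‖²`. -/
def kernelDiag (Ω : Set (Fin n → ℂ)) (z : Fin n → ℂ) : ℝ :=
  (bergmanKernel Ω z z).re

/-- The Wirtinger derivative `∂g/∂z_i = (∂g/∂x_i - i ∂g/∂y_i) / 2`. -/
def dz (i : Fin n) (g : (Fin n → ℂ) → ℂ) (z : Fin n → ℂ) : ℂ :=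
  (fderiv ℝ g z (Pi.single i 1) - Complex.I * fderiv ℝ g z (Pi.single i Complex.I)) / 2

/-- The Wirtinger derivative `∂g/∂z̄_i = (∂g/∂x_i + i ∂g/∂y_i) / 2`. -/
def dzbar (i : Fin n) (g : (Fin n → ℂ) → ℂ) (z : Fin n → ℂ) : ℂ :=
  (fderiv ℝ g z (Pi.single i 1) + Complex.I * fderiv ℝ g z (Pi.single i Complex.I)) / 2

/-- The complex Hessian `(∂²u/∂z_i∂z̄_j)` of a real-valued function `u`. -/
def complexHessian (u : (Fin n → ℂ) → ℝ) (z : Fin n → ℂ) : Matrix (Fin n) (Fin n) ℂ :=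
  Matrix.of fun i j => dz i (dzbar j fun w => (u w : ℂ)) z

/-- The Bergman metric tensor `T = ∂∂̄ log K`. -/
def bergmanMetric (Ω : Set (Fin n → ℂ)) (z : Fin n → ℂ) : Matrix (Fin n) (Fin n) ℂ :=
  complexHessian (fun w => Real.log (kernelDiag Ω w)) z

/-- The determinant of the Bergman metric tensor, which is real since the tensor is Hermitian. -/
def bergmanDet (Ω : Set (Fin n → ℂ)) (z : Fin n → ℂ) : ℝ :=
  (bergmanMetric Ω z).det.re

/-- The Ricci tensor of the Bergman metric, `Ric = -∂∂̄ log det T`. -/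
def ricci (Ω : Set (Fin n → ℂ)) (z : Fin n → ℂ) : Matrix (Fin n) (Fin n) ℂ :=
  -complexHessian (fun w => Real.log (bergmanDet Ω w)) z

/-- The metric tensor `T̃ = (n + 1) T - Ric`. -/
def tildeMetric (Ω : Set (Fin n → ℂ)) (z : Fin n → ℂ) : Matrix (Fin n) (Fin n) ℂ :=
  ((n : ℂ) + 1) • bergmanMetric Ω z - ricci Ω z

/-- The length `(∑ T̃_{ij}(z) X_i X̄_j)^{1/2}` of the vector `X` at the point `z`. -/
def tildeLength (Ω : Set (Fin n → ℂ)) (z X : Fin n → ℂ) : ℝ :=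
  Real.sqrt (∑ i, ∑ j, tildeMetric Ω z i j * X i * starRingEnd ℂ (X j)).re

/-- Continuous piecewise `C¹` curves `[0, 1] → Ω` from `z` to `ζ`: off finitely many break points
the curve is `C¹`, up to the end points of each piece. -/
structure IsCurve (Ω : Set (Fin n → ℂ)) (z ζ : Fin n → ℂ) (γ : ℝ → Fin n → ℂ) : Prop where
  continuousOn : ContinuousOn γ (Icc 0 1)
  piecewise : ∃ S : Finset ℝ, ∀ a b : ℝ, 0 ≤ a → a < b → b ≤ 1 →
    (∀ t ∈ S, t ∉ Ioo a b) → ContDiffOn ℝ 1 γ (Icc a b)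
  mapsTo : MapsTo γ (Icc 0 1) Ω
  source : γ 0 = z
  target : γ 1 = ζ

/-- The distance of `T̃`: the infimum of the lengths of the curves in `Ω` joining two points. -/
def tildeDist (Ω : Set (Fin n → ℂ)) (z ζ : Fin n → ℂ) : ℝ :=
  sInf {L : ℝ | ∃ γ, IsCurve Ω z ζ γ ∧ L = ∫ t in (0 : ℝ)..1, tildeLength Ω (γ t) (deriv γ t)}

/-- Completeness of `T̃`: every Cauchy sequence in `Ω` for its distance has a limit in `Ω`. -/
def TildeComplete (Ω : Set (Fin n → ℂ)) : Prop :=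
  ∀ u : ℕ → Fin n → ℂ, (∀ k, u k ∈ Ω) →
    (∀ ε > 0, ∃ N, ∀ k ≥ N, ∀ l ≥ N, tildeDist Ω (u k) (u l) < ε) →
    ∃ p ∈ Ω, Tendsto (fun k => tildeDist Ω (u k) p) atTop (𝓝 0)

/-- The matrix with first row `f_0(z), …, f_n(z)` and further rows
`∂f_0/∂z_i(z), …, ∂f_n/∂z_i(z)` for `i = 1, …, n`. -/
def jetMatrix (f : Fin (n + 1) → (Fin n → ℂ) → ℂ) (z : Fin n → ℂ) :
    Matrix (Fin (n + 1)) (Fin (n + 1)) ℂ :=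
  Matrix.of fun i j => Fin.cases (f j z) (fun k => fderiv ℂ (f j) z (Pi.single k 1)) i

/-- The Gram determinant `det(⟨f_j, f_i⟩)`, which is real since the matrix is Hermitian. -/
def gramDet (Ω : Set (Fin n → ℂ)) (f : Fin (n + 1) → (Fin n → ℂ) → ℂ) : ℝ :=
  (Matrix.of fun i j => l2Inner Ω (f j) (f i)).det.re

end BergmanRicci

end

/-! Let `k z` be the vector of the Bergman space that represents evaluation at `z`. The map `z ↦ k
z` is antiholomorphic. Wedging it with its first partial derivatives gives an antiholomorphic map Φ
= k ∧ ∂₁k ∧ ⋯ ∧ ∂ₙk into a Hilbert space of antisymmetric functions. A Schur complement gives ‖Φ‖² =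
Kⁿ⁺¹ det T, hence T̃ = ∂∂̄ log ‖Φ‖²: the tensor T̃ is the pullback under Φ of the Fubini–Study
metric on lines (`IsKernelModel.det_bergmanMetric`, `IsKernelModel.tildeMetric_eq`).

The determinant in the criterion is ⟨f₀ ∧ ⋯ ∧ fₙ, Φ(z)⟩, linear in the first entry. So the quotient
is the squared norm of the projection of ω = f₀ ∧ ⋯ ∧ fₙ to the line ℂΦ(z), while the Gram
determinant is ‖ω‖². The hypothesis thus says that near the boundary the lines ℂΦ(z) never converge
to the line of a nonzero decomposable ω.

Along a curve the projection of a fixed vector v to ℂΦ moves with speed at most 2‖v‖ times the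
T̃-speed (`hasDerivWithinAt_lineProj`). Along a T̃-Cauchy sequence the lines therefore converge to
the line of some ω ≠ 0, and ω is decomposable because limits of decomposable elements are
(`IsWedge.exists_apply_eq_of_tendsto`). A Euclidean limit point on the boundary would make the
quotient tend to ‖ω‖², against the strict inequality. So there is a limit point inside Ω, where
T̃-distance is controlled by Euclidean distance, and the whole Cauchy sequence converges to it. -/

noncomputable section

namespace BergmanRicci

variable {n : ℕ}

/-! ### Wedge products in Hilbert spaces -/

section Wedge

variable {H E : Type*} [NormedAddCommGroup H] [InnerProductSpace ℂ H]
  [NormedAddCommGroup E] [InnerProductSpace ℂ E] {N : ℕ}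

/-- A multilinear map realizes the wedge product if the inner products of its values are the
mixed Gram determinants. -/
def IsWedge (W : ContinuousMultilinearMap ℂ (fun _ : Fin N => H) E) : Prop :=
  ∀ f g, inner ℂ (W f) (W g) = (Matrix.of fun a b => inner ℂ (f a) (g b)).det

/-- Multiplicativity of the determinant makes both sides have the same inner product with every
value of `W`. Their difference is a combination of two such values, hence orthogonal to itself. -/
theorem IsWedge.apply_linearCombination {W : ContinuousMultilinearMap ℂ (fun _ : Fin N => H) E}
    (hW : IsWedge W) (B : Matrix (Fin N) (Fin N) ℂ) (h : Fin N → H) :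
    W (fun a => ∑ b, B b a • h b) = B.det • W h := by
  have key : ∀ g, inner ℂ (W g) (W (fun a => ∑ b, B b a • h b)) =
      inner ℂ (W g) (B.det • W h) := by
    intro g
    rw [inner_smul_right, hW, hW, mul_comm, ← Matrix.det_mul]
    congr 1
    ext a b
    simp [Matrix.mul_apply, mul_comm]
  rw [← sub_eq_zero, ← inner_self_eq_zero (𝕜 := ℂ), inner_sub_left, inner_smul_left,
    inner_sub_right, inner_sub_right, key, key h, sub_self, sub_self, mul_zero, sub_zero]

theorem IsWedge.norm_sq {W : ContinuousMultilinearMap ℂ (fun _ : Fin N => H) E}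
    (hW : IsWedge W) (f : Fin N → H) :
    ((‖W f‖ ^ 2 : ℝ) : ℂ) = (Matrix.of fun a b => inner ℂ (f a) (f b)).det := by
  rw [← hW, inner_self_eq_norm_sq_to_K]; norm_cast

/-- The wedge product of linearly dependent vectors vanishes. -/
theorem IsWedge.linearIndependent {W : ContinuousMultilinearMap ℂ (fun _ : Fin N => H) E}
    (hW : IsWedge W) {f : Fin N → H} (hf : W f ≠ 0) : LinearIndependent ℂ f := by
  rw [Fintype.linearIndependent_iff]
  intro c hc
  by_contra hne
  push Not at hne
  have : (Matrix.of fun a b => inner ℂ (f a) (f b)).det = 0 := by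
    rw [← Matrix.exists_mulVec_eq_zero_iff]
    refine ⟨c, fun h => ?_, ?_⟩
    · obtain ⟨i, hi⟩ := hne
      exact hi (congrFun h i)
    · ext a
      have : inner ℂ (f a) (∑ b, c b • f b) = 0 := by rw [hc, inner_zero_right]
      simpa [Matrix.mulVec, dotProduct, inner_sum, inner_smul_right, mul_comm] using this
  rw [← hW, inner_self_eq_zero] at this
  exact hf this

variable [CompleteSpace H] [CompleteSpace E]

/-- The contraction of an element of `E` with all but one of the vectors `e_0, …, e_n`. -/
def contraction (W : ContinuousMultilinearMap ℂ (fun _ : Fin N => H) E) (e : Fin N → H)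
    (a : Fin N) : E →L[ℂ] H :=
  ContinuousLinearMap.adjoint (W.toContinuousLinearMap e a)

/-- Pairing with `x` gives the mixed Gram determinant with row `a` replaced by the products with
`x`; Cramer's rule expands it along that row. -/
theorem IsWedge.contraction_apply {W : ContinuousMultilinearMap ℂ (fun _ : Fin N => H) E}
    (hW : IsWedge W) (e h : Fin N → H) (a : Fin N) :
    contraction W e a (W h) =
      ∑ b, (Matrix.of fun a b => inner ℂ (e a) (h b)).adjugate b a • h b := by
  refine ext_inner_left ℂ fun x => ?_
  rw [contraction, ContinuousLinearMap.adjoint_inner_right]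
  have : W.toContinuousLinearMap e a x = W (Function.update e a x) := rfl
  rw [this, hW]
  set A : Matrix (Fin N) (Fin N) ℂ := Matrix.of fun a b => inner ℂ (e a) (h b)
  have h1 : (Matrix.of fun c b => inner ℂ (Function.update e a x c) (h b)) =
      A.updateRow a (fun b => inner ℂ x (h b)) := by
    ext c b
    by_cases hc : c = a
    · subst hc; simp
    · simp [hc, A]
  rw [h1, ← Matrix.cramer_transpose_apply, Matrix.cramer_eq_adjugate_mulVec,
    ← Matrix.adjugate_transpose, inner_sum]
  simp [Matrix.mulVec, dotProduct, inner_smul_right]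

/-- A Plücker-type identity: the contractions are combinations of the `h b` with an adjugate as
coefficient matrix, whose determinant is an `n`-th power. Both sides depend on `h` only through `W
h`, and continuously, so the identity survives limits. -/
theorem IsWedge.apply_contraction
    {W : ContinuousMultilinearMap ℂ (fun _ : Fin (n + 1) => H) E}
    (hW : IsWedge W) (e h : Fin (n + 1) → H) :
    W (fun a => contraction W e a (W h)) = (inner ℂ (W e) (W h)) ^ n • W h := by
  simp_rw [hW.contraction_apply]
  rw [hW.apply_linearCombination, Matrix.det_adjugate, hW]
  simp

/-- Limits of decomposable elements are decomposable. -/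
theorem IsWedge.exists_apply_eq_of_tendsto
    {W : ContinuousMultilinearMap ℂ (fun _ : Fin (n + 1) => H) E} (hW : IsWedge W)
    {h : ℕ → Fin (n + 1) → H} {ω : E} (hω : Tendsto (fun k => W (h k)) atTop (𝓝 ω))
    (hω0 : ω ≠ 0) : ∃ f, W f = ω := by
  -- Otherwise `ω` would be orthogonal to its own approximants, hence to itself.
  obtain ⟨e, he⟩ : ∃ e, inner ℂ (W e) ω ≠ 0 := by
    by_contra! hcon
    have h1 : Tendsto (fun k => inner ℂ (W (h k)) ω) atTop (𝓝 (inner ℂ ω ω)) :=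
      hω.inner tendsto_const_nhds
    simp_rw [hcon] at h1
    exact hω0 (inner_self_eq_zero.1 (tendsto_nhds_unique h1 tendsto_const_nhds))
  have h1 : Tendsto (fun k => W (fun a => contraction W e a (W (h k)))) atTop
      (𝓝 (W (fun a => contraction W e a ω))) := by
    have hc : Continuous fun η : E => W (fun a => contraction W e a η) :=
      W.cont.comp (continuous_pi fun a => (contraction W e a).continuous)
    exact (hc.tendsto ω).comp hω
  have h2 : Tendsto (fun k => (inner ℂ (W e) (W (h k))) ^ n • W (h k)) atTop
      (𝓝 ((inner ℂ (W e) ω) ^ n • ω)) :=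
    ((tendsto_const_nhds.inner hω).pow n).smul hω
  simp_rw [hW.apply_contraction] at h1
  have h3 := tendsto_nhds_unique h1 h2
  set g := fun a => contraction W e a ω
  -- The unwanted scalar factor is absorbed into one slot.
  refine ⟨Function.update g 0 (((inner ℂ (W e) ω) ^ n)⁻¹ • g 0), ?_⟩
  rw [W.map_update_smul, Function.update_eq_self, h3, smul_smul,
    inv_mul_cancel₀ (pow_ne_zero _ he), one_smul]

end Wedge

/-! ### The wedge product of square-integrable functions -/

section LpWedge

variable {α : Type*} [MeasurableSpace α] (μ : Measure α) [IsFiniteMeasure μ] {N : ℕ}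

theorem memLp_prod (f : Fin N → Lp ℂ 2 μ) :
    MemLp (fun w : Fin N → α => ∏ a, f a (w a)) 2 (Measure.pi fun _ => μ) := by
  rw [memLp_two_iff_integrable_sq_norm]
  · have := Integrable.fintype_prod (μ := fun _ : Fin N => μ) (f := fun a x => ‖f a x‖ ^ 2)
      (fun a => (memLp_two_iff_integrable_sq_norm (Lp.aestronglyMeasurable _)).1 (Lp.memLp (f a)))
    simpa [norm_prod, Finset.prod_pow] using this
  · refine Finset.aestronglyMeasurable_fun_prod _ fun a _ => ?_
    exact (Lp.aestronglyMeasurable (f a)).comp_quasiMeasurePreserving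
      (Measure.quasiMeasurePreserving_eval (fun _ : Fin N => μ) a)

/-- The function `f_0(w_0) ⋯ f_{N-1}(w_{N-1})` of several variables. -/
def lpProd (f : Fin N → Lp ℂ 2 μ) : Lp ℂ 2 (Measure.pi fun _ : Fin N => μ) :=
  (memLp_prod μ f).toLp _

theorem coeFn_lpProd (f : Fin N → Lp ℂ 2 μ) :
    lpProd μ f =ᵐ[Measure.pi fun _ => μ] fun w => ∏ a, f a (w a) :=
  MemLp.coeFn_toLp _

theorem inner_lpProd (f g : Fin N → Lp ℂ 2 μ) :
    inner ℂ (lpProd μ f) (lpProd μ g) = ∏ a, inner ℂ (f a) (g a) := by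
  simp_rw [L2.inner_def]
  rw [← integral_fintype_prod_eq_prod]
  refine integral_congr_ae ?_
  filter_upwards [coeFn_lpProd μ f, coeFn_lpProd μ g] with w h1 h2
  rw [h1, h2]
  simp [Finset.prod_mul_distrib]

theorem ae_pi_of_ae {P : α → Prop} (h : ∀ᵐ x ∂μ, P x) (a : Fin N) :
    ∀ᵐ w ∂(Measure.pi fun _ : Fin N => μ), P (w a) :=
  (Measure.quasiMeasurePreserving_eval (fun _ : Fin N => μ) a).ae h

/-- The product of functions of separate variables as a multilinear map. -/
def lpProdMultilinear :
    MultilinearMap ℂ (fun _ : Fin N => Lp ℂ 2 μ) (Lp ℂ 2 (Measure.pi fun _ : Fin N => μ)) :=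
  MultilinearMap.mk' (lpProd μ)
    (by
      intro f a x y
      refine Lp.ext ?_
      filter_upwards [coeFn_lpProd μ (Function.update f a (x + y)),
        coeFn_lpProd μ (Function.update f a x), coeFn_lpProd μ (Function.update f a y),
        Lp.coeFn_add (lpProd μ (Function.update f a x)) (lpProd μ (Function.update f a y)),
        ae_pi_of_ae μ (Lp.coeFn_add x y) a] with w h1 h2 h3 h4 h5
      rw [h4, Pi.add_apply, h1, h2, h3]
      have := (MultilinearMap.mkPiAlgebra ℂ (Fin N) ℂ).map_update_add (fun b => f b (w b)) a
        (x (w a)) (y (w a))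
      simp only [MultilinearMap.mkPiAlgebra_apply] at this
      convert this using 3 <;> (rename_i b _; by_cases hb : b = a <;> [subst hb; skip] <;>
        simp_all))
    (by
      intro f a c x
      refine Lp.ext ?_
      filter_upwards [coeFn_lpProd μ (Function.update f a (c • x)),
        coeFn_lpProd μ (Function.update f a x),
        Lp.coeFn_smul c (lpProd μ (Function.update f a x)),
        ae_pi_of_ae μ (Lp.coeFn_smul c x) a] with w h1 h2 h4 h5
      rw [h4, Pi.smul_apply, h1, h2]
      have := (MultilinearMap.mkPiAlgebra ℂ (Fin N) ℂ).map_update_smul (fun b => f b (w b)) a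
        c (x (w a))
      simp only [MultilinearMap.mkPiAlgebra_apply] at this
      convert this using 3 <;> (rename_i b _; by_cases hb : b = a <;> [subst hb; skip] <;>
        simp_all))

theorem norm_lpProd (f : Fin N → Lp ℂ 2 μ) : ‖lpProd μ f‖ = ∏ a, ‖f a‖ := by
  have h := inner_lpProd μ f f
  simp_rw [inner_self_eq_norm_sq_to_K] at h
  rw [Finset.prod_pow] at h
  have h' : ‖lpProd μ f‖ ^ 2 = (∏ a, ‖f a‖) ^ 2 := by
    apply Complex.ofReal_injective
    push_cast
    simpa using h
  exact (pow_left_inj₀ (norm_nonneg _) (Finset.prod_nonneg fun _ _ => norm_nonneg _)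
    two_ne_zero).1 h'

/-- The wedge product `f_0 ∧ ⋯ ∧ f_{N-1}` as an antisymmetric function of several variables. -/
def lpWedgeMultilinear :
    MultilinearMap ℂ (fun _ : Fin N => Lp ℂ 2 μ) (Lp ℂ 2 (Measure.pi fun _ : Fin N => μ)) :=
  -- This normalization makes the inner product exactly the Gram determinant, without a factor `N!`.
  (((Real.sqrt (N.factorial))⁻¹ : ℝ) : ℂ) • (MultilinearMap.alternatization
    (lpProdMultilinear μ (N := N))).toMultilinearMap

theorem lpWedgeMultilinear_apply (f : Fin N → Lp ℂ 2 μ) :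
    lpWedgeMultilinear μ f = (((Real.sqrt (N.factorial))⁻¹ : ℝ) : ℂ) •
      ∑ σ : Equiv.Perm (Fin N), (Equiv.Perm.sign σ : ℤ) • lpProd μ (fun a => f (σ a)) := by
  simp only [lpWedgeMultilinear, _root_.smul_apply,
    AlternatingMap.coe_multilinearMap, MultilinearMap.alternatization_apply]
  rfl

/-- For each fixed permutation on the right, the sum over permutations on the left is already the
determinant; the `N!` equal terms cancel the two normalizing factors. -/
theorem inner_lpWedgeMultilinear (f g : Fin N → Lp ℂ 2 μ) :
    inner ℂ (lpWedgeMultilinear μ f) (lpWedgeMultilinear μ g) =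
      (Matrix.of fun a b => inner ℂ (f a) (g b)).det := by
  set A : Matrix (Fin N) (Fin N) ℂ := Matrix.of fun a b => inner ℂ (f a) (g b)
  have h1 : ∀ τ : Equiv.Perm (Fin N),
      ∑ σ : Equiv.Perm (Fin N), inner ℂ ((Equiv.Perm.sign σ : ℤ) • lpProd μ (fun a => f (σ a)))
        ((Equiv.Perm.sign τ : ℤ) • lpProd μ (fun a => g (τ a))) = A.det := by
    intro τ
    have h2 : A.det = (Equiv.Perm.sign τ : ℤ) * (A.submatrix id τ).det := by
      rw [Matrix.det_permute']
      rcases Int.units_eq_one_or (Equiv.Perm.sign τ) with h | h <;> simp [h]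
    rw [h2, Matrix.det_apply', Finset.mul_sum]
    refine Finset.sum_congr rfl fun σ _ => ?_
    rw [← Int.cast_smul_eq_zsmul ℂ, ← Int.cast_smul_eq_zsmul ℂ, inner_smul_left,
      inner_smul_right, inner_lpProd]
    simp [A]
    ring
  rw [lpWedgeMultilinear_apply, lpWedgeMultilinear_apply, inner_smul_left, inner_smul_right,
    inner_sum]
  simp_rw [sum_inner, h1]
  rw [Finset.sum_const, Finset.card_univ, Fintype.card_perm, Fintype.card_fin, Complex.conj_ofReal,
    nsmul_eq_mul, ← mul_assoc, ← mul_assoc, ← Complex.ofReal_mul, ← mul_inv,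
    Real.mul_self_sqrt (Nat.cast_nonneg _)]
  have : (N.factorial : ℂ) ≠ 0 := by exact_mod_cast N.factorial_ne_zero
  push_cast
  rw [inv_mul_cancel₀ this, one_mul]

/-- The wedge product of square-integrable functions as a continuous multilinear map. -/
def lpWedge : ContinuousMultilinearMap ℂ (fun _ : Fin N => Lp ℂ 2 μ)
    (Lp ℂ 2 (Measure.pi fun _ : Fin N => μ)) :=
  (lpWedgeMultilinear μ).mkContinuous ((Real.sqrt (N.factorial))⁻¹ * N.factorial) (by
    intro f
    rw [lpWedgeMultilinear_apply, norm_smul, Complex.norm_real, Real.norm_of_nonneg (by positivity),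
      mul_assoc]
    gcongr
    refine (norm_sum_le _ _).trans ?_
    have : ∀ σ : Equiv.Perm (Fin N),
        ‖(Equiv.Perm.sign σ : ℤ) • lpProd μ (fun a => f (σ a))‖ = ∏ a, ‖f a‖ := by
      intro σ
      rw [← Equiv.prod_comp σ (fun a => ‖f a‖), ← norm_lpProd]
      rcases Int.units_eq_one_or (Equiv.Perm.sign σ) with h | h <;> simp [h]
    simp_rw [this]
    simp [Fintype.card_perm])

theorem isWedge_lpWedge : IsWedge (lpWedge μ (N := N)) := inner_lpWedgeMultilinear μ

end LpWedge

/-! ### The complex Hessian of the logarithm of the squared norm of an antiholomorphic map -/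

section FubiniStudy

variable {E : Type*} [NormedAddCommGroup E] [InnerProductSpace ℂ E]

/-- The real derivative of `F` at `z` is conjugate linear, as for an antiholomorphic map. -/
def IsConjLinearAt (F : (Fin n → ℂ) → E) (z : Fin n → ℂ) : Prop :=
  ∀ X, fderiv ℝ F z (Complex.I • X) = -(Complex.I • fderiv ℝ F z X)

theorem single_I (i : Fin n) :
    (Pi.single i Complex.I : Fin n → ℂ) = Complex.I • Pi.single i 1 := by
  rw [← Pi.single_smul]; simp

/-- The inner product is conjugate linear in its first slot, so for antiholomorphic `F` only the
second slot contributes to ∂/∂z̄. -/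
theorem dzbar_log_norm_sq {F : (Fin n → ℂ) → E} {z : Fin n → ℂ} (hF : DifferentiableAt ℝ F z)
    (hanti : IsConjLinearAt F z) (h0 : F z ≠ 0) (j : Fin n) :
    dzbar j (fun w => ((Real.log (‖F w‖ ^ 2) : ℝ) : ℂ)) z =
      inner ℂ (F z) (fderiv ℝ F z (Pi.single j 1)) / inner ℂ (F z) (F z) := by
  have hn : ‖F z‖ ^ 2 ≠ 0 := pow_ne_zero _ (norm_ne_zero_iff.2 h0)
  have hsq : (fun w => ‖F w‖ ^ 2) = fun w => Complex.reCLM (inner ℂ (F w) (F w)) := by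
    ext w
    exact (inner_self_eq_norm_sq (𝕜 := ℂ) (F w)).symm
  have h1 : HasFDerivAt (fun w => ‖F w‖ ^ 2) (Complex.reCLM.comp
      ((fderivInnerCLM ℂ (F z, F z)).comp ((fderiv ℝ F z).prod (fderiv ℝ F z)))) z := by
    rw [hsq]
    exact Complex.reCLM.hasFDerivAt.comp z (hF.hasFDerivAt.inner ℂ hF.hasFDerivAt)
  have h2 := Complex.ofRealCLM.hasFDerivAt.comp z (h1.log hn)
  have h3 : ∀ X, fderiv ℝ (fun w => ((Real.log (‖F w‖ ^ 2) : ℝ) : ℂ)) z X =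
      ((‖F z‖ ^ 2)⁻¹ * (2 * (inner ℂ (F z) (fderiv ℝ F z X)).re) : ℝ) := by
    intro X
    have heq : (fun w => ((Real.log (‖F w‖ ^ 2) : ℝ) : ℂ)) =
        Complex.ofRealCLM ∘ fun w => Real.log (‖F w‖ ^ 2) := rfl
    rw [heq, h2.fderiv]
    have : (inner ℂ (fderiv ℝ F z X) (F z)).re = (inner ℂ (F z) (fderiv ℝ F z X)).re :=
      inner_re_symm (𝕜 := ℂ) _ _
    simp only [ContinuousLinearMap.comp_apply, smul_apply, ContinuousLinearMap.prod_apply,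
      fderivInnerCLM_apply, Complex.reCLM_apply, Complex.ofRealCLM_apply, Complex.add_re, this,
      smul_eq_mul, two_mul]
  rw [dzbar, h3, h3, single_I, hanti, inner_neg_right, inner_smul_right,
    inner_self_eq_norm_sq_to_K]
  have hn' : (‖F z‖ : ℂ) ≠ 0 := by simpa using h0
  set c := inner ℂ (F z) (fderiv ℝ F z (Pi.single j 1))
  have : (-(Complex.I * c)).re = c.im := by simp
  rw [this]
  conv_rhs => rw [← Complex.re_add_im c]
  push_cast
  simp only [Complex.coe_algebraMap]
  field_simp

/-- Symmetry of the second derivative moves the factor `I` to the direction in which conjugate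
linearity is known. -/
theorem isConjLinearAt_fderiv_apply {F : (Fin n → ℂ) → E} {z : Fin n → ℂ}
    (hF : ContDiffAt ℝ 2 F z) (hanti : ∀ᶠ w in 𝓝 z, IsConjLinearAt F w) (v : Fin n → ℂ) :
    IsConjLinearAt (fun w => fderiv ℝ F w v) z := by
  have hd : DifferentiableAt ℝ (fderiv ℝ F) z :=
    (hF.fderiv_right (m := 1) (by norm_num)).differentiableAt (by norm_num)
  have happ : ∀ u X, fderiv ℝ (fun w => fderiv ℝ F w u) z X = fderiv ℝ (fderiv ℝ F) z X u := by
    intro u X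
    rw [fderiv_clm_apply hd (differentiableAt_const _)]
    simp
  have hsymm := hF.isSymmSndFDerivAt (by simp)
  intro X
  rw [happ, happ, hsymm, ← happ, hsymm X v]
  have : (fun w => fderiv ℝ F w (Complex.I • X)) =ᶠ[𝓝 z]
      fun w => -(Complex.I • fderiv ℝ F w X) := hanti.mono fun w hw => hw X
  rw [this.fderiv_eq, fderiv_fun_neg, fderiv_fun_const_smul]
  · simp [happ]
  · exact hd.clm_apply (differentiableAt_const _)

/-- Dual to the ∂/∂z̄ computation: only the first slots contribute to ∂/∂z. With `G` a partial
derivative of `F` this yields the Hessian of log ‖F‖². -/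
theorem dz_inner_div {F G : (Fin n → ℂ) → E} {z : Fin n → ℂ} (hF : DifferentiableAt ℝ F z)
    (hFa : IsConjLinearAt F z) (hG : DifferentiableAt ℝ G z) (hGa : IsConjLinearAt G z)
    (h0 : F z ≠ 0) (i : Fin n) :
    dz i (fun w => inner ℂ (F w) (G w) / inner ℂ (F w) (F w)) z =
      (inner ℂ (fderiv ℝ F z (Pi.single i 1)) (G z) * inner ℂ (F z) (F z) -
        inner ℂ (fderiv ℝ F z (Pi.single i 1)) (F z) * inner ℂ (F z) (G z)) /
        inner ℂ (F z) (F z) ^ 2 := by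
  have hn : inner ℂ (F z) (F z) ≠ 0 := inner_self_eq_zero.not.2 h0
  have hu := hF.hasFDerivAt.inner ℂ hG.hasFDerivAt
  have hv := hF.hasFDerivAt.inner ℂ hF.hasFDerivAt
  set h : (Fin n → ℂ) → ℂ := fun w => inner ℂ (F w) (G w) / inner ℂ (F w) (F w)
  have hd : DifferentiableAt ℝ h z := by
    simp only [h, div_eq_mul_inv]
    exact hu.differentiableAt.mul (hv.differentiableAt.inv hn)
  -- The quotient is differentiated implicitly, through its product with the denominator.
  have hprod : (fun w => h w * inner ℂ (F w) (F w)) =ᶠ[𝓝 z] fun w => inner ℂ (F w) (G w) := by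
    filter_upwards [hv.continuousAt.eventually_ne hn] with w hw
    exact div_mul_cancel₀ _ hw
  have hX : ∀ X, fderiv ℝ h z X = ((inner ℂ (F z) (fderiv ℝ G z X) +
      inner ℂ (fderiv ℝ F z X) (G z)) * inner ℂ (F z) (F z) - inner ℂ (F z) (G z) *
      (inner ℂ (F z) (fderiv ℝ F z X) + inner ℂ (fderiv ℝ F z X) (F z))) /
        inner ℂ (F z) (F z) ^ 2 := by
    intro X
    have h1 := (hd.hasFDerivAt.mul hv).unique (hu.congr_of_eventuallyEq hprod)
    have h2 := congrArg (fun L => L X) h1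
    simp only [add_apply, smul_apply, ContinuousLinearMap.comp_apply,
      ContinuousLinearMap.prod_apply, fderivInnerCLM_apply, smul_eq_mul] at h2
    rw [eq_div_iff (pow_ne_zero _ hn)]
    have h3 : h z * inner ℂ (F z) (F z) = inner ℂ (F z) (G z) := div_mul_cancel₀ _ hn
    linear_combination inner ℂ (F z) (F z) * h2 - (inner ℂ (F z) (fderiv ℝ F z X) +
      inner ℂ (fderiv ℝ F z X) (F z)) * h3
  rw [dz, hX, hX, single_I, hFa, hGa]
  simp only [inner_neg_right, inner_neg_left, inner_smul_left, inner_smul_right, Complex.conj_I]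
  field_simp
  ring_nf
  simp only [Complex.I_sq]
  ring

theorem complexHessian_log_norm_sq {F : (Fin n → ℂ) → E} {z : Fin n → ℂ}
    (hF : ContDiffAt ℝ 2 F z) (hanti : ∀ᶠ w in 𝓝 z, IsConjLinearAt F w) (h0 : F z ≠ 0)
    (i j : Fin n) :
    complexHessian (fun w => Real.log (‖F w‖ ^ 2)) z i j =
      (inner ℂ (fderiv ℝ F z (Pi.single i 1)) (fderiv ℝ F z (Pi.single j 1)) *
          inner ℂ (F z) (F z) -
        inner ℂ (fderiv ℝ F z (Pi.single i 1)) (F z) *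
          inner ℂ (F z) (fderiv ℝ F z (Pi.single j 1))) / inner ℂ (F z) (F z) ^ 2 := by
  have hd : DifferentiableAt ℝ F z := hF.differentiableAt (by norm_num)
  have hd2 : DifferentiableAt ℝ (fderiv ℝ F) z :=
    (hF.fderiv_right (m := 1) (by norm_num)).differentiableAt (by norm_num)
  have hev : (dzbar j fun w => ((Real.log (‖F w‖ ^ 2) : ℝ) : ℂ)) =ᶠ[𝓝 z] fun w =>
      inner ℂ (F w) (fderiv ℝ F w (Pi.single j 1)) / inner ℂ (F w) (F w) := by
    filter_upwards [hanti, hd.continuousAt.eventually_ne h0,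
      (hF.eventually (by simp)).mono fun w hw => hw.differentiableAt (by norm_num)]
      with w h1 h2 h3
    exact dzbar_log_norm_sq h3 h1 h2 j
  rw [complexHessian, Matrix.of_apply, dz, hev.fderiv_eq, ← dz]
  exact dz_inner_div hd hanti.self_of_nhds (hd2.clm_apply (differentiableAt_const _))
    (isConjLinearAt_fderiv_apply hF hanti _) h0 i

theorem fderiv_eq_sum_of_isConjLinearAt {F : (Fin n → ℂ) → E} {z : Fin n → ℂ}
    (hanti : IsConjLinearAt F z) (X : Fin n → ℂ) :
    fderiv ℝ F z X = ∑ i, starRingEnd ℂ (X i) • fderiv ℝ F z (Pi.single i 1) := by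
  have hsm : ∀ (c : ℂ) (Y : Fin n → ℂ), fderiv ℝ F z (c • Y) =
      starRingEnd ℂ c • fderiv ℝ F z Y := by
    intro c Y
    have : c • Y = c.re • Y + c.im • (Complex.I • Y) := by
      ext k
      simp only [Pi.smul_apply, Pi.add_apply, smul_eq_mul, Complex.real_smul]
      conv_lhs => rw [← Complex.re_add_im c]
      ring
    rw [this, map_add, map_smul, map_smul, hanti, ← Complex.coe_smul c.re, ← Complex.coe_smul c.im,
      smul_neg, smul_smul, ← neg_smul, ← add_smul]
    congr 1
    apply Complex.ext <;> simp
  have : X = ∑ i, X i • Pi.single i (1 : ℂ) := by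
    ext k; simp [Finset.sum_apply, Pi.single_apply]
  conv_lhs => rw [this]
  rw [map_sum]
  simp_rw [hsm]

/-- The squared Fubini–Study length of the vector `v` at the point `x`. -/
def fsSq (x v : E) : ℝ := (‖v‖ ^ 2 * ‖x‖ ^ 2 - ‖inner ℂ x v‖ ^ 2) / ‖x‖ ^ 4

/-- Conjugate linearity of the derivative collects the sums over `i` and `j` into inner products
with the single vector `fderiv ℝ F z X`. This is the pullback statement for the Fubini–Study metric.
-/
theorem sum_complexHessian_log_norm_sq {F : (Fin n → ℂ) → E} {z : Fin n → ℂ}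
    (hF : ContDiffAt ℝ 2 F z) (hanti : ∀ᶠ w in 𝓝 z, IsConjLinearAt F w) (h0 : F z ≠ 0)
    (X : Fin n → ℂ) :
    ∑ i, ∑ j, complexHessian (fun w => Real.log (‖F w‖ ^ 2)) z i j * X i * starRingEnd ℂ (X j) =
      fsSq (F z) (fderiv ℝ F z X) := by
  have hV := fderiv_eq_sum_of_isConjLinearAt hanti.self_of_nhds X
  set V := fderiv ℝ F z X
  set v := fun i => fderiv ℝ F z (Pi.single i 1)
  have h1 : inner ℂ V V = ∑ i, ∑ j, inner ℂ (v i) (v j) * X i * starRingEnd ℂ (X j) := by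
    rw [hV, sum_inner]
    refine Finset.sum_congr rfl fun i _ => ?_
    rw [inner_sum]
    refine Finset.sum_congr rfl fun j _ => ?_
    simp [inner_smul_left, inner_smul_right, v]
    ring
  have h2 : inner ℂ V (F z) = ∑ i, inner ℂ (v i) (F z) * X i := by
    rw [hV, sum_inner]
    refine Finset.sum_congr rfl fun i _ => ?_
    simp [inner_smul_left, v]
    ring
  have h3 : inner ℂ (F z) V = ∑ j, inner ℂ (F z) (v j) * starRingEnd ℂ (X j) := by
    rw [hV, inner_sum]
    refine Finset.sum_congr rfl fun i _ => ?_
    simp [inner_smul_right, v]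
    ring
  have h4 : ((‖inner ℂ (F z) V‖ ^ 2 : ℝ) : ℂ) = inner ℂ V (F z) * inner ℂ (F z) V := by
    rw [← inner_conj_symm V (F z), mul_comm, Complex.mul_conj, Complex.normSq_eq_norm_sq]
  have h5 : ∀ x : E, ((‖x‖ ^ 2 : ℝ) : ℂ) = inner ℂ x x := fun x => by
    rw [inner_self_eq_norm_sq_to_K]; norm_cast
  have h6 : (fsSq (F z) V : ℂ) = (inner ℂ V V * inner ℂ (F z) (F z) -
      inner ℂ V (F z) * inner ℂ (F z) V) / inner ℂ (F z) (F z) ^ 2 := by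
    rw [← h4, ← h5, ← h5, fsSq]
    push_cast
    ring
  rw [h6, h1, h2, h3, Finset.sum_mul_sum, Finset.sum_mul, ← Finset.sum_sub_distrib,
    Finset.sum_div]
  refine Finset.sum_congr rfl fun i _ => ?_
  rw [Finset.sum_mul, ← Finset.sum_sub_distrib, Finset.sum_div]
  refine Finset.sum_congr rfl fun j _ => ?_
  rw [complexHessian_log_norm_sq hF hanti h0]
  ring

theorem fsSq_le {x : E} (v : E) : fsSq x v ≤ (‖v‖ / ‖x‖) ^ 2 := by
  rcases eq_or_ne x 0 with rfl | hx
  · simp [fsSq]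
  have : ‖x‖ ≠ 0 := norm_ne_zero_iff.2 hx
  rw [fsSq, div_pow, div_le_div_iff₀ (by positivity) (by positivity)]
  have : 0 ≤ ‖inner ℂ x v‖ ^ 2 * ‖x‖ ^ 2 := by positivity
  nlinarith

end FubiniStudy

/-! ### The mean value property with respect to a circular bump function -/

section MeanValue

open scoped ContDiff

/-- A smooth function of the Euclidean norm supported in the Euclidean ball of radius `r`. -/
def preBump (r : ℝ) (w : Fin n → ℂ) : ℝ :=
  Real.smoothTransition (r ^ 2 - ∑ i, Complex.normSq (w i))

/-- A smooth probability density on `ℂⁿ`, supported near `0` and invariant under the circle. -/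
def bump (r : ℝ) (w : Fin n → ℂ) : ℝ :=
  (∫ v : Fin n → ℂ, preBump r v)⁻¹ * preBump r w

theorem contDiff_preBump (r : ℝ) : ContDiff ℝ ∞ (preBump (n := n) r) := by
  refine Real.smoothTransition.contDiff.comp ?_
  refine contDiff_const.sub (ContDiff.sum fun i _ => ?_)
  simp only [Complex.normSq_apply]
  have h : ContDiff ℝ ∞ (fun w : Fin n → ℂ => w i) := contDiff_apply ℝ ℂ i
  have hre := Complex.reCLM.contDiff (n := ∞).comp h
  have him := Complex.imCLM.contDiff (n := ∞).comp h
  exact (hre.mul hre).add (him.mul him)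

theorem preBump_eq_zero {r : ℝ} (hr : 0 < r) {w : Fin n → ℂ} (hw : r < ‖w‖) :
    preBump r w = 0 := by
  refine Real.smoothTransition.zero_of_nonpos ?_
  -- The norm is the sup norm, so one coordinate alone exceeds `r`.
  obtain ⟨i, hi⟩ : ∃ i, r < ‖w i‖ := by
    by_contra! h
    exact absurd ((pi_norm_le_iff_of_nonneg hr.le).2 h) (not_le.2 hw)
  have h1 : Complex.normSq (w i) ≤ ∑ i, Complex.normSq (w i) :=
    Finset.single_le_sum (f := fun i => Complex.normSq (w i))
      (fun j _ => Complex.normSq_nonneg _) (Finset.mem_univ i)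
  rw [Complex.normSq_eq_norm_sq] at h1
  nlinarith

theorem hasCompactSupport_preBump {r : ℝ} (hr : 0 < r) :
    HasCompactSupport (preBump (n := n) r) := by
  refine HasCompactSupport.intro (isCompact_closedBall 0 r) fun w hw => preBump_eq_zero hr ?_
  simpa using hw

theorem integral_preBump_pos {r : ℝ} (hr : 0 < r) : 0 < ∫ v : Fin n → ℂ, preBump r v := by
  refine (contDiff_preBump r).continuous.integral_pos_of_hasCompactSupport_nonneg_nonzero
    (hasCompactSupport_preBump hr) (fun w => Real.smoothTransition.nonneg _) (x := 0) ?_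
  refine (Real.smoothTransition.pos_of_pos ?_).ne'
  have : 0 < r ^ 2 := by positivity
  simpa using this

theorem contDiff_bump (r : ℝ) : ContDiff ℝ ∞ (bump (n := n) r) :=
  contDiff_const.mul (contDiff_preBump r)

theorem bump_eq_zero {r : ℝ} (hr : 0 < r) {w : Fin n → ℂ} (hw : r < ‖w‖) : bump r w = 0 := by
  rw [bump, preBump_eq_zero hr hw, mul_zero]

theorem hasCompactSupport_bump {r : ℝ} (hr : 0 < r) : HasCompactSupport (bump (n := n) r) :=
  (hasCompactSupport_preBump hr).mul_left

theorem integral_bump {r : ℝ} (hr : 0 < r) : ∫ w : Fin n → ℂ, bump r w = 1 := by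
  simp only [bump, integral_const_mul]
  exact inv_mul_cancel₀ (integral_preBump_pos hr).ne'

theorem bump_smul (r : ℝ) {c : ℂ} (hc : ‖c‖ = 1) (w : Fin n → ℂ) : bump r (c • w) = bump r w := by
  simp [bump, preBump, Complex.normSq_eq_norm_sq, hc]

theorem measurePreserving_unit_smul {c : ℂ} (hc : ‖c‖ = 1) :
    MeasurePreserving (fun w : Fin n → ℂ => c • w) volume volume := by
  have h : MeasurePreserving (fun x : ℂ => c * x) volume volume :=
    (rotation ⟨c, by simpa [Submonoid.unitSphere] using hc⟩).measurePreserving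
  exact volume_preserving_pi (fun _ : Fin n => h)

theorem integral_unit_smul {c : ℂ} (hc : ‖c‖ = 1) (g : (Fin n → ℂ) → ℂ) :
    ∫ w, g (c • w) = ∫ w, g w := by
  have hc0 : c ≠ 0 := by rintro rfl; simp at hc
  exact (measurePreserving_unit_smul hc).integral_comp
    (Homeomorph.smulOfNeZero c hc0).measurableEmbedding g

/-- The mean value property of a holomorphic function for a circular density. -/
theorem setIntegral_bump_mul {Ω : Set (Fin n → ℂ)} {f : (Fin n → ℂ) → ℂ}
    (hf : DifferentiableOn ℂ f Ω) {z : Fin n → ℂ} {r : ℝ} (hr : 0 < r)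
    (hz : Metric.closedBall z r ⊆ Ω) :
    ∫ w in Ω, (bump r (w - z) : ℂ) * f w = f z := by
  have h1 : ∫ w in Ω, (bump r (w - z) : ℂ) * f w = ∫ w, (bump r w : ℂ) * f (z + w) := by
    rw [setIntegral_eq_integral_of_forall_compl_eq_zero,
      ← integral_add_left_eq_self (fun w => (bump r (w - z) : ℂ) * f w) z]
    · simp
    · intro w hw
      rw [bump_eq_zero hr, Complex.ofReal_zero, zero_mul]
      by_contra! h
      exact hw (hz (by simpa [dist_eq_norm] using h))
  rw [h1]
  set B : Set (Fin n → ℂ) := Metric.closedBall 0 r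
  -- Density and Lebesgue measure are invariant under the circle, so rotating the argument of `f`
  -- does not change the integral.
  have h2 : ∀ θ : ℝ, ∫ w in B, (bump r w : ℂ) * f (z + circleMap 0 1 θ • w) =
      ∫ w, (bump r w : ℂ) * f (z + w) := by
    intro θ
    have hθ : ‖circleMap 0 1 θ‖ = 1 := by simp
    rw [setIntegral_eq_integral_of_forall_compl_eq_zero,
      ← integral_unit_smul hθ (fun w => (bump r w : ℂ) * f (z + w))]
    · simp_rw [bump_smul r hθ]
    · intro w hw
      rw [bump_eq_zero hr, Complex.ofReal_zero, zero_mul]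
      simpa [B] using hw
  have hmem : ∀ c : ℂ, ‖c‖ ≤ 1 → ∀ w ∈ B, z + c • w ∈ Ω := by
    intro c hc w hw
    refine hz ?_
    have : ‖w‖ ≤ r := by simpa [B] using hw
    simp only [Metric.mem_closedBall, dist_eq_norm, add_sub_cancel_left, norm_smul]
    calc ‖c‖ * ‖w‖ ≤ 1 * r := by gcongr
      _ = r := one_mul r
  -- The one-variable mean value property on the disc `c ↦ z + c • w`.
  have h3 : ∀ w ∈ B, ∫ θ in (0 : ℝ)..2 * Real.pi, f (z + circleMap 0 1 θ • w) =
      2 * Real.pi * f z := by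
    intro w hw
    have hd : DifferentiableOn ℂ (fun c : ℂ => f (z + c • w)) (Metric.closedBall 0 1) := by
      refine hf.comp (by fun_prop) fun c hc => hmem c (by simpa using hc) w hw
    have hdc : DiffContOnCl ℂ (fun c : ℂ => f (z + c • w)) (Metric.ball 0 |1|) := by
      rw [abs_one]
      refine DifferentiableOn.diffContOnCl ?_
      rwa [closure_ball _ one_ne_zero]
    have := hdc.circleAverage
    rw [Real.circleAverage_def, zero_smul, add_zero] at this
    rw [← this, Complex.real_smul]
    push_cast
    field_simp
  have hint : IntegrableOn (fun p : ℝ × (Fin n → ℂ) =>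
      (bump r p.2 : ℂ) * f (z + circleMap 0 1 p.1 • p.2)) (Ioc 0 (2 * Real.pi) ×ˢ B)
      (volume.prod volume) := by
    refine IntegrableOn.mono_set ?_
      (prod_mono (Ioc_subset_Icc_self (a := (0 : ℝ)) (b := 2 * Real.pi)) (Subset.refl B))
    refine ContinuousOn.integrableOn_compact (isCompact_Icc.prod (isCompact_closedBall 0 r)) ?_
    refine ContinuousOn.mul ?_ ?_
    · exact (Complex.continuous_ofReal.comp
        ((contDiff_bump r).continuous.comp continuous_snd)).continuousOn
    · refine hf.continuousOn.comp (Continuous.continuousOn ?_) fun p hp =>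
        hmem _ (by simp) _ hp.2
      exact continuous_const.add (((continuous_circleMap 0 1).comp continuous_fst).smul
        continuous_snd)
  -- Averaging over the angle and exchanging the integrals compares the two evaluations.
  have h4 : ∫ θ in Ioc 0 (2 * Real.pi), ∫ w in B,
      (bump r w : ℂ) * f (z + circleMap 0 1 θ • w) = ∫ w in B, ∫ θ in Ioc 0 (2 * Real.pi),
      (bump r w : ℂ) * f (z + circleMap 0 1 θ • w) := by
    refine integral_integral_swap ?_
    rw [Measure.prod_restrict]
    exact hint
  simp_rw [h2] at h4
  have h5 : ∫ w in B, ∫ θ in Ioc 0 (2 * Real.pi),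
      (bump r w : ℂ) * f (z + circleMap 0 1 θ • w) =
      ∫ w in B, (bump r w : ℂ) * (2 * Real.pi * f z) := by
    refine setIntegral_congr_fun Metric.isClosed_closedBall.measurableSet fun w hw => ?_
    simp only [integral_const_mul]
    rw [← h3 w hw, intervalIntegral.integral_of_le Real.two_pi_pos.le]
  have h6 : ∫ w in B, (bump r w : ℂ) = 1 := by
    rw [setIntegral_eq_integral_of_forall_compl_eq_zero, integral_complex_ofReal, integral_bump hr,
      Complex.ofReal_one]
    intro w hw
    rw [bump_eq_zero hr, Complex.ofReal_zero]
    simpa [B] using hw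
  rw [h5, integral_mul_const, h6, one_mul, setIntegral_const] at h4
  have hpi : (Real.pi : ℂ) ≠ 0 := by exact_mod_cast Real.pi_ne_zero
  simp only [Measure.real, Real.volume_Ioc, sub_zero, ENNReal.toReal_ofReal Real.two_pi_pos.le,
    Complex.real_smul] at h4
  push_cast at h4
  exact mul_left_cancel₀ (mul_ne_zero two_ne_zero hpi) h4

end MeanValue

/-! ### Smoothness of translation -/

section Translation

open scoped BoundedContinuousFunction ContDiff

variable {V : Type*} [NormedAddCommGroup V]

/-- The translate `φ(· - z)` of a continuous function with compact support. -/
def translate (φ : V → ℂ) (hc : Continuous φ) (hs : HasCompactSupport φ) (z : V) : V →ᵇ ℂ :=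
  BoundedContinuousFunction.ofNormedAddCommGroup (fun w => φ (w - z))
    (hc.comp (continuous_id.sub continuous_const)) (hs.exists_bound_of_continuous hc).choose
    fun w => (hs.exists_bound_of_continuous hc).choose_spec (w - z)

@[simp]
theorem translate_apply (φ : V → ℂ) (hc : Continuous φ) (hs : HasCompactSupport φ) (z w : V) :
    translate φ hc hs z w = φ (w - z) := rfl

variable [NormedSpace ℝ V] {X : Type*} [NormedAddCommGroup X] [NormedSpace ℂ X]

theorem hasCompactSupport_fderiv_apply {φ : V → ℂ} (hs : HasCompactSupport φ) (v : V) :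
    HasCompactSupport fun w => fderiv ℝ φ w v :=
  (hs.fderiv ℝ).comp_left (g := fun L : V →L[ℝ] ℂ => L v) (by simp)

variable [FiniteDimensional ℝ V]

/-- The derivative of `φ` is Lipschitz, so the first-order Taylor remainder is quadratic in the
increment uniformly in the point, that is, in the sup norm. -/
theorem hasFDerivAt_translate (T : (V →ᵇ ℂ) →L[ℂ] X) {φ : V → ℂ} (hφ : ContDiff ℝ ∞ φ)
    (hs : HasCompactSupport φ) (z : V) :
    HasFDerivAt (fun z => T (translate φ hφ.continuous hs z))
      (∑ i, ((Module.finBasis ℝ V).coord i).toContinuousLinearMap.smulRight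
        (-T (translate (fun w => fderiv ℝ φ w (Module.finBasis ℝ V i))
          ((hφ.continuous_fderiv (by simp)).clm_apply continuous_const)
          (hasCompactSupport_fderiv_apply hs _) z))) z := by
  set b := Module.finBasis ℝ V
  have hd : ContDiff ℝ ∞ (fderiv ℝ φ) := hφ.fderiv_right (by simp)
  obtain ⟨C, hC⟩ := hd.lipschitzWith_of_hasCompactSupport (hs.fderiv ℝ) (by simp)
  rw [hasFDerivAt_iff_isLittleO_nhds_zero]
  have hO : (fun h => T (translate φ hφ.continuous hs (z + h)) -
      T (translate φ hφ.continuous hs z) - (∑ i, (b.coord i).toContinuousLinearMap.smulRight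
        (-T (translate (fun w => fderiv ℝ φ w (b i))
          ((hφ.continuous_fderiv (by simp)).clm_apply continuous_const)
          (hasCompactSupport_fderiv_apply hs _) z))) h) =O[𝓝 0] fun h : V => ‖h‖ ^ 2 := by
    refine Asymptotics.IsBigO.of_bound (‖T‖ * C) (Eventually.of_forall fun h => ?_)
    have hsum : (∑ i, (b.coord i).toContinuousLinearMap.smulRight
        (-T (translate (fun w => fderiv ℝ φ w (b i))
          ((hφ.continuous_fderiv (by simp)).clm_apply continuous_const)
          (hasCompactSupport_fderiv_apply hs _) z))) h =
        T (∑ i, ((b.coord i h : ℝ) : ℂ) • -(translate (fun w => fderiv ℝ φ w (b i))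
          ((hφ.continuous_fderiv (by simp)).clm_apply continuous_const)
          (hasCompactSupport_fderiv_apply hs _) z)) := by
      simp [map_sum]
    rw [hsum, ← map_sub, ← map_sub]
    refine (T.le_opNorm _).trans ?_
    rw [mul_assoc]
    gcongr
    rw [BoundedContinuousFunction.norm_le (by positivity)]
    intro w
    have hmv := (convex_closedBall (w - z) ‖h‖).norm_image_sub_le_of_norm_fderiv_le'
      (f := φ) (𝕜 := ℝ) (C := C * ‖h‖) (φ := fderiv ℝ φ (w - z)) (x := w - z) (y := w - z - h)
      (fun x _ => hφ.differentiable (by simp) x)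
      (fun x hx => by
        rw [← dist_eq_norm]
        refine (hC.dist_le_mul _ _).trans ?_
        gcongr
        simpa using hx)
      (by simp) (by simp)
    have hsum2 : fderiv ℝ φ (w - z) h = ∑ i, ((b.coord i h : ℝ) : ℂ) *
        fderiv ℝ φ (w - z) (b i) := by
      have := congrArg (fderiv ℝ φ (w - z)) (b.sum_repr h).symm
      rw [map_sum] at this
      simpa only [map_smul, Complex.real_smul, Module.Basis.coord_apply] using this
    simp only [BoundedContinuousFunction.coe_sub, Pi.sub_apply, BoundedContinuousFunction.coe_sum,
      Finset.sum_apply, BoundedContinuousFunction.coe_smul, translate_apply,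
      BoundedContinuousFunction.coe_neg, Pi.neg_apply, smul_eq_mul, mul_neg,
      Finset.sum_neg_distrib, ← hsum2]
    have h1 : w - z - h - (w - z) = -h := by abel
    rw [h1, map_neg, norm_neg] at hmv
    rw [norm_pow, norm_norm, pow_two, ← mul_assoc, ← sub_sub]
    exact hmv
  exact hO.trans_isLittleO (Asymptotics.isLittleO_norm_pow_id one_lt_two)

/-- The derivative of a translate is built from translates of partial derivatives, which are of the
same kind, so induction applies. Through it the kernel vectors become a smooth Hilbert-space valued
map of `z`. -/
theorem contDiff_translate (T : (V →ᵇ ℂ) →L[ℂ] X) {φ : V → ℂ} (hφ : ContDiff ℝ ∞ φ)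
    (hs : HasCompactSupport φ) :
    ContDiff ℝ ∞ fun z => T (translate φ hφ.continuous hs z) := by
  rw [contDiff_infty]
  intro m
  induction m generalizing φ with
  | zero =>
    exact contDiff_zero.2 (continuous_iff_continuousAt.2 fun z =>
      (hasFDerivAt_translate T hφ hs z).continuousAt)
  | succ m ih =>
    refine contDiff_succ_iff_hasFDerivAt.2 ⟨_, ?_, hasFDerivAt_translate T hφ hs⟩
    refine ContDiff.sum fun i _ => ?_
    refine contDiff_const.smulRight (ContDiff.neg ?_)
    exact ih ((hφ.fderiv_right (by simp)).clm_apply contDiff_const) _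

end Translation

/-! ### The Bergman space -/

theorem inner_orthogonalProjectionOnto_comp {X B : Type*} [NormedAddCommGroup X]
    [InnerProductSpace ℂ X] [NormedAddCommGroup B] [NormedSpace ℂ B] (K : Submodule ℂ X)
    [K.HasOrthogonalProjection] (T : B →L[ℂ] X) (b : B) (g : K) :
    inner ℂ ((K.orthogonalProjectionOnto.comp T) b) g = inner ℂ (T b) (g : X) := by
  rw [ContinuousLinearMap.comp_apply, ← Submodule.inner_orthogonalProjectionOnto_eq_of_mem_right]

/-! ### Complex differentiability of pairings with a Hilbert-space valued map. -/

section WeakHolomorphy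

variable {X : Type*} [NormedAddCommGroup X] [InnerProductSpace ℂ X]

theorem differentiableAt_inner_const_and_fderiv {ψ : (Fin n → ℂ) → X} {z : Fin n → ℂ}
    (hψ : DifferentiableAt ℝ ψ z) (g : X) :
    DifferentiableAt ℝ (fun w => inner ℂ (ψ w) g) z ∧
      ∀ Y, fderiv ℝ (fun w => inner ℂ (ψ w) g) z Y = inner ℂ (fderiv ℝ ψ z Y) g := by
  have h := hψ.hasFDerivAt.inner ℂ (hasFDerivAt_const g z)
  refine ⟨h.differentiableAt, fun Y => ?_⟩
  rw [h.fderiv]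
  simp

/-- The Cauchy–Riemann equations, written as orthogonality conditions on `g`. They give closedness
in `g`, and conversely conjugate linearity of the derivative of `ψ` once all pairings are
holomorphic. -/
theorem differentiableAt_inner_iff {ψ : (Fin n → ℂ) → X} {z : Fin n → ℂ}
    (hψ : DifferentiableAt ℝ ψ z) (g : X) :
    DifferentiableAt ℂ (fun w => inner ℂ (ψ w) g) z ↔
      ∀ Y, inner ℂ (fderiv ℝ ψ z (Complex.I • Y) + Complex.I • fderiv ℝ ψ z Y) g = 0 := by
  obtain ⟨hd, hD⟩ := differentiableAt_inner_const_and_fderiv hψ g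
  have key : ∀ Y, inner ℂ (fderiv ℝ ψ z (Complex.I • Y) + Complex.I • fderiv ℝ ψ z Y) g =
      fderiv ℝ (fun w => inner ℂ (ψ w) g) z (Complex.I • Y) -
        Complex.I * fderiv ℝ (fun w => inner ℂ (ψ w) g) z Y := by
    intro Y
    rw [hD, hD, inner_add_left, inner_smul_left, Complex.conj_I]
    ring
  simp_rw [key, sub_eq_zero]
  rw [differentiableAt_iff_restrictScalars ℝ hd]
  constructor
  · rintro ⟨L, hL⟩ Y
    rw [← hL]
    simp
  · intro h
    refine ⟨{ toFun := fderiv ℝ (fun w => inner ℂ (ψ w) g) z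
              map_add' := map_add _
              map_smul' := fun c Y => ?_
              cont := (fderiv ℝ (fun w => inner ℂ (ψ w) g) z).continuous }, rfl⟩
    have hc : c • Y = c.re • Y + c.im • (Complex.I • Y) := by
      ext k
      simp only [Pi.smul_apply, Pi.add_apply, smul_eq_mul, Complex.real_smul]
      conv_lhs => rw [← Complex.re_add_im c]
      ring
    rw [hc, map_add, map_smul, map_smul, h]
    simp only [Complex.real_smul, smul_eq_mul, RingHom.id_apply]
    conv_rhs => rw [← Complex.re_add_im c]
    ring

theorem isClosed_setOf_differentiableAt_inner {ψ : (Fin n → ℂ) → X} {z : Fin n → ℂ}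
    (hψ : DifferentiableAt ℝ ψ z) :
    IsClosed {g : X | DifferentiableAt ℂ (fun w => inner ℂ (ψ w) g) z} := by
  simp_rw [differentiableAt_inner_iff hψ]
  rw [ofPred_forall]
  exact isClosed_iInter fun Y => isClosed_eq (by fun_prop) continuous_const

end WeakHolomorphy

/-! ### Point evaluations by mollifiers and the Hilbert space model. -/

section Mollifier

open scoped BoundedContinuousFunction ContDiff

theorem contDiff_ofReal_bump (r : ℝ) : ContDiff ℝ ∞ fun w : Fin n → ℂ => (bump r w : ℂ) :=
  Complex.ofRealCLM.contDiff.comp (contDiff_bump r)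

theorem hasCompactSupport_ofReal_bump {r : ℝ} (hr : 0 < r) :
    HasCompactSupport fun w : Fin n → ℂ => (bump r w : ℂ) :=
  (hasCompactSupport_bump hr).comp_left Complex.ofReal_zero

/-- The bump function centred at `z`. -/
def mollifier {r : ℝ} (hr : 0 < r) (z : Fin n → ℂ) : (Fin n → ℂ) →ᵇ ℂ :=
  translate _ (contDiff_ofReal_bump r).continuous (hasCompactSupport_ofReal_bump hr) z

theorem contDiff_mollifier {X : Type*} [NormedAddCommGroup X] [NormedSpace ℂ X]
    (T : ((Fin n → ℂ) →ᵇ ℂ) →L[ℂ] X) {r : ℝ} (hr : 0 < r) :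
    ContDiff ℝ ∞ fun z => T (mollifier hr z) :=
  contDiff_translate T (contDiff_ofReal_bump r) (hasCompactSupport_ofReal_bump hr)

theorem isClosed_setOf_differentiableAt_mollifier {X : Type*} [NormedAddCommGroup X]
    [InnerProductSpace ℂ X] (T : ((Fin n → ℂ) →ᵇ ℂ) →L[ℂ] X) {r : ℝ} (hr : 0 < r)
    (z : Fin n → ℂ) :
    IsClosed {g : X | DifferentiableAt ℂ (fun w => inner ℂ (T (mollifier hr w)) g) z} :=
  isClosed_setOf_differentiableAt_inner ((contDiff_mollifier T hr).differentiable (by simp) z)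

variable {Ω : Set (Fin n → ℂ)}

theorem isFiniteMeasure_restrict (hbdd : Bornology.IsBounded Ω) :
    IsFiniteMeasure (volume.restrict Ω) :=
  ⟨by simpa using hbdd.measure_lt_top⟩

theorem inner_mollifier [IsFiniteMeasure (volume.restrict Ω)] {r : ℝ} (hr : 0 < r)
    {z : Fin n → ℂ} (hz : Metric.closedBall z r ⊆ Ω) {f : (Fin n → ℂ) → ℂ}
    (hf : DifferentiableOn ℂ f Ω) {g : Lp ℂ 2 (volume.restrict Ω)}
    (hg : g =ᵐ[volume.restrict Ω] f) :
    inner ℂ (BoundedContinuousFunction.toLp 2 (volume.restrict Ω) ℂ (mollifier hr z)) g =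
      f z := by
  rw [← setIntegral_bump_mul hf hr hz, L2.inner_def]
  refine integral_congr_ae ?_
  filter_upwards [hg, BoundedContinuousFunction.coeFn_toLp (p := 2) (𝕜 := ℂ) (volume.restrict Ω)
    (mollifier hr z)] with w h1 h2
  rw [h1, h2]
  simp [mollifier, mul_comm]

variable (Ω) in
/-- The square-integrable holomorphic functions as a subspace of `L²(Ω)`. -/
def bergmanSpace : Submodule ℂ (Lp ℂ 2 (volume.restrict Ω)) where
  carrier := {g | ∃ f, DifferentiableOn ℂ f Ω ∧ g =ᵐ[volume.restrict Ω] f}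
  add_mem' := by
    rintro g g' ⟨f, hf, hg⟩ ⟨f', hf', hg'⟩
    exact ⟨f + f', hf.add hf', (Lp.coeFn_add g g').trans (hg.add hg')⟩
  zero_mem' := ⟨0, differentiableOn_const 0, Lp.coeFn_zero _ _ _⟩
  smul_mem' := by
    rintro c g ⟨f, hf, hg⟩
    exact ⟨c • f, hf.const_smul c, (Lp.coeFn_smul c g).trans (hg.const_smul c)⟩

theorem exists_closedBall_subset (hopen : IsOpen Ω) {z : Fin n → ℂ} (hz : z ∈ Ω) :
    ∃ r > 0, ∀ᶠ w in 𝓝 z, Metric.closedBall w r ⊆ Ω := by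
  obtain ⟨r, hr, hball⟩ := Metric.isOpen_iff.1 hopen z hz
  refine ⟨r / 2, by positivity, ?_⟩
  filter_upwards [Metric.ball_mem_nhds z (by positivity : 0 < r / 2)] with w hw
  refine (Metric.closedBall_subset_ball' ?_).trans hball
  have := Metric.mem_ball.1 hw
  linarith

/-- Point values are pairings with mollifiers, so L² convergence implies pointwise convergence.
Differentiability of such a pairing is a closed condition, hence the limit is holomorphic; an a.e.
convergent subsequence identifies it with the L² limit. -/
theorem isClosed_bergmanSpace (hopen : IsOpen Ω) (hbdd : Bornology.IsBounded Ω) :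
    IsClosed (bergmanSpace Ω : Set (Lp ℂ 2 (volume.restrict Ω))) := by
  have := isFiniteMeasure_restrict hbdd
  refine isClosed_of_closure_subset fun g hg => ?_
  obtain ⟨u, hu, hlim⟩ := mem_closure_iff_seq_limit.1 hg
  choose f hf hfu using hu
  set T := BoundedContinuousFunction.toLp (α := Fin n → ℂ) (E := ℂ) 2 (volume.restrict Ω) ℂ
  have h1 : ∀ (z) (r) (hr : 0 < r), Metric.closedBall z r ⊆ Ω →
      Tendsto (fun m => f m z) atTop (𝓝 (inner ℂ (T (mollifier hr z)) g)) := by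
    intro z r hr hz
    have : Tendsto (fun m => inner ℂ (T (mollifier hr z)) (u m)) atTop
        (𝓝 (inner ℂ (T (mollifier hr z)) g)) := tendsto_const_nhds.inner hlim
    refine this.congr fun m => inner_mollifier hr hz (hf m) (hfu m)
  refine ⟨fun z => limUnder atTop fun m => f m z, fun z hz => ?_, ?_⟩
  · obtain ⟨r, hr, hev⟩ := exists_closedBall_subset hopen hz
    refine DifferentiableAt.differentiableWithinAt ?_
    have h2 : (fun z => limUnder atTop fun m => f m z) =ᶠ[𝓝 z]
        fun w => inner ℂ (T (mollifier hr w)) g :=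
      hev.mono fun w hw => (h1 w r hr hw).limUnder_eq
    rw [h2.differentiableAt_iff]
    refine (isClosed_setOf_differentiableAt_mollifier T hr z).mem_of_tendsto hlim
      (Eventually.of_forall fun m => ?_)
    have h3 : (fun w => inner ℂ (T (mollifier hr w)) (u m)) =ᶠ[𝓝 z] f m :=
      hev.mono fun w hw => inner_mollifier hr hw (hf m) (hfu m)
    exact h3.differentiableAt_iff.2 ((hf m).differentiableAt (hopen.mem_nhds hz))
  · obtain ⟨ns, hmono, hns⟩ := (tendstoInMeasure_of_tendsto_Lp hlim).exists_seq_tendsto_ae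
    filter_upwards [hns, ae_all_iff.2 hfu, ae_restrict_mem hopen.measurableSet] with w hw1 hw2 hw3
    obtain ⟨r, hr, hev⟩ := exists_closedBall_subset hopen hw3
    have h2 := h1 w r hr hev.self_of_nhds
    rw [h2.limUnder_eq]
    exact tendsto_nhds_unique hw1
      ((h2.comp hmono.tendsto_atTop).congr fun i => (hw2 (ns i)).symm)

/-- A realization of the space of square-integrable holomorphic functions as a Hilbert space `H`
together with the vectors `k z` that represent the evaluations. -/
structure IsKernelModel (Ω : Set (Fin n → ℂ)) {H : Type*} [NormedAddCommGroup H]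
    [InnerProductSpace ℂ H] (k : (Fin n → ℂ) → H) : Prop where
  contDiffAt : ∀ z ∈ Ω, ContDiffAt ℝ ∞ k z
  isL2Holomorphic : ∀ g, IsL2Holomorphic Ω fun z => inner ℂ (k z) g
  l2Inner_eq : ∀ g g', l2Inner Ω (fun z => inner ℂ (k z) g) (fun z => inner ℂ (k z) g') =
    inner ℂ g' g
  exists_eq : ∀ f, IsL2Holomorphic Ω f → ∃ g, ∀ z ∈ Ω, inner ℂ (k z) g = f z

/-- The kernel vector at `z` is the orthogonal projection of a mollifier centred at `z`. The radius
can be kept fixed near each point and does not affect the projection, so smoothness of translation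
passes to the kernel. -/
theorem exists_isKernelModel (hopen : IsOpen Ω) (hbdd : Bornology.IsBounded Ω) :
    CompleteSpace (bergmanSpace Ω) ∧ ∃ k : (Fin n → ℂ) → bergmanSpace Ω, IsKernelModel Ω k := by
  have := isFiniteMeasure_restrict hbdd
  have hcomp : CompleteSpace (bergmanSpace Ω) :=
    (isClosed_bergmanSpace hopen hbdd).completeSpace_coe
  refine ⟨hcomp, ?_⟩
  set T : ((Fin n → ℂ) →ᵇ ℂ) →L[ℂ] bergmanSpace Ω :=
    (bergmanSpace Ω).orthogonalProjectionOnto.comp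
      (BoundedContinuousFunction.toLp (α := Fin n → ℂ) (E := ℂ) 2 (volume.restrict Ω) ℂ)
  have hT : ∀ (z : Fin n → ℂ) (r : ℝ) (hr : 0 < r), Metric.closedBall z r ⊆ Ω →
      ∀ (g : bergmanSpace Ω) (f : (Fin n → ℂ) → ℂ), DifferentiableOn ℂ f Ω →
      (g : Lp ℂ 2 (volume.restrict Ω)) =ᵐ[volume.restrict Ω] f →
      inner ℂ (T (mollifier hr z)) g = f z := by
    intro z r hr hz g f hf hg
    rw [← inner_mollifier hr hz hf hg]
    exact inner_orthogonalProjectionOnto_comp _ _ _ _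
  have hex : ∀ z ∈ Ω, ∃ k : bergmanSpace Ω, ∀ (g : bergmanSpace Ω) (f : (Fin n → ℂ) → ℂ),
      DifferentiableOn ℂ f Ω → (g : Lp ℂ 2 (volume.restrict Ω)) =ᵐ[volume.restrict Ω] f →
      inner ℂ k g = f z := by
    intro z hz
    obtain ⟨r, hr, hev⟩ := exists_closedBall_subset hopen hz
    exact ⟨_, hT z r hr hev.self_of_nhds⟩
  choose! k hk using hex
  have hrep : ∀ g : bergmanSpace Ω, ∃ f, DifferentiableOn ℂ f Ω ∧
      ((g : Lp ℂ 2 (volume.restrict Ω)) =ᵐ[volume.restrict Ω] f) ∧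
      ∀ z ∈ Ω, inner ℂ (k z) g = f z := by
    rintro ⟨g, f, hf, hg⟩
    exact ⟨f, hf, hg, fun z hz => hk z hz _ f hf hg⟩
  have hae : ∀ g : bergmanSpace Ω, ((g : Lp ℂ 2 (volume.restrict Ω)) =ᵐ[volume.restrict Ω]
      fun z => inner ℂ (k z) g) := by
    intro g
    obtain ⟨f, hf, hg, hfk⟩ := hrep g
    filter_upwards [hg, ae_restrict_mem hopen.measurableSet] with w h1 h2
    rw [h1, hfk w h2]
  refine ⟨k, ?_, ?_, ?_, ?_⟩
  · intro z hz
    obtain ⟨r, hr, hev⟩ := exists_closedBall_subset hopen hz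
    refine ((contDiff_mollifier T hr).contDiffAt (x := z)).congr_of_eventuallyEq ?_
    filter_upwards [hev, hopen.mem_nhds hz] with w hw hwΩ
    refine ext_inner_right ℂ fun g => ?_
    obtain ⟨f, hf, hg, hfk⟩ := hrep g
    rw [hfk w hwΩ, hT w r hr hw g f hf hg]
  · intro g
    obtain ⟨f, hf, hg, hfk⟩ := hrep g
    exact ⟨hf.congr hfk, (memLp_congr_ae (hae g)).1 (Lp.memLp g.1)⟩
  · intro g g'
    rw [Submodule.coe_inner, L2.inner_def, l2Inner]
    refine integral_congr_ae ?_
    filter_upwards [hae g, hae g'] with w h1 h2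
    rw [h1, h2]
    simp
  · intro f hf
    exact ⟨⟨hf.2.toLp f, f, hf.1, hf.2.coeFn_toLp⟩, fun z hz => hk z hz _ f hf.1
      hf.2.coeFn_toLp⟩

end Mollifier

/-! ### Calculus of the complex Hessian -/

section Hessian

theorem complexHessian_congr {u v : (Fin n → ℂ) → ℝ} {z : Fin n → ℂ} (h : u =ᶠ[𝓝 z] v) :
    complexHessian u z = complexHessian v z := by
  ext i j
  have h1 : (dzbar j fun w => (u w : ℂ)) =ᶠ[𝓝 z] dzbar j fun w => (v w : ℂ) := by
    filter_upwards [h.eventuallyEq_nhds] with w hw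
    have : (fun w => (u w : ℂ)) =ᶠ[𝓝 w] fun w => (v w : ℂ) := hw.mono fun x hx => by simp [hx]
    simp only [dzbar, this.fderiv_eq]
  simp only [complexHessian, Matrix.of_apply, dz, h1.fderiv_eq]

theorem differentiableAt_dzbar {P : (Fin n → ℂ) → ℂ} {z : Fin n → ℂ} (hP : ContDiffAt ℝ 2 P z)
    (j : Fin n) : DifferentiableAt ℝ (dzbar j P) z := by
  have hd : DifferentiableAt ℝ (fderiv ℝ P) z :=
    (hP.fderiv_right (m := 1) (by norm_num)).differentiableAt (by norm_num)
  have h : ∀ v : Fin n → ℂ, DifferentiableAt ℝ (fun w => fderiv ℝ P w v) z := fun v =>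
    hd.clm_apply (differentiableAt_const _)
  exact ((h _).add ((differentiableAt_const _).mul (h _))).mul (differentiableAt_const _)

theorem complexHessian_sub_mul {u v : (Fin n → ℂ) → ℝ} {z : Fin n → ℂ}
    (hu : ContDiffAt ℝ 2 (fun w => (u w : ℂ)) z) (hv : ContDiffAt ℝ 2 (fun w => (v w : ℂ)) z)
    (c : ℝ) :
    complexHessian (fun w => u w - c * v w) z =
      complexHessian u z - (c : ℂ) • complexHessian v z := by
  ext i j
  have h1 : (dzbar j fun w => ((u w - c * v w : ℝ) : ℂ)) =ᶠ[𝓝 z] fun w =>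
      dzbar j (fun w => (u w : ℂ)) w - c * dzbar j (fun w => (v w : ℂ)) w := by
    filter_upwards [hu.eventually (by simp), hv.eventually (by simp)] with w hw1 hw2
    have hd1 := hw1.differentiableAt (by norm_num)
    have hd2 := hw2.differentiableAt (by norm_num)
    have : fderiv ℝ (fun w => ((u w - c * v w : ℝ) : ℂ)) w =
        fderiv ℝ (fun w => (u w : ℂ)) w - (c : ℂ) • fderiv ℝ (fun w => (v w : ℂ)) w := by
      push_cast
      rw [fderiv_fun_sub hd1 (hd2.const_mul _), fderiv_const_mul hd2]
    simp only [dzbar, this, sub_apply, smul_apply, smul_eq_mul]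
    ring
  have hd1 := differentiableAt_dzbar hu j
  have hd2 := differentiableAt_dzbar hv j
  simp only [complexHessian, Matrix.of_apply, Matrix.sub_apply, Matrix.smul_apply, dz,
    h1.fderiv_eq]
  rw [fderiv_fun_sub hd1 (hd2.const_mul _), fderiv_const_mul hd2]
  simp only [sub_apply, smul_apply, smul_eq_mul]
  ring

theorem contDiffAt_log_norm_sq {E : Type*} [NormedAddCommGroup E] [InnerProductSpace ℂ E]
    {F : (Fin n → ℂ) → E} {z : Fin n → ℂ} (hF : ContDiffAt ℝ 2 F z) (h0 : F z ≠ 0) :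
    ContDiffAt ℝ 2 (fun w => ((Real.log (‖F w‖ ^ 2) : ℝ) : ℂ)) z := by
  have hsq : (fun w => ‖F w‖ ^ 2) = fun w => Complex.reCLM (inner ℂ (F w) (F w)) := by
    ext w
    exact (inner_self_eq_norm_sq (𝕜 := ℂ) (F w)).symm
  have h1 : ContDiffAt ℝ 2 (fun w => ‖F w‖ ^ 2) z := by
    rw [hsq]
    exact Complex.reCLM.contDiff.contDiffAt.comp z (hF.inner ℂ hF)
  exact Complex.ofRealCLM.contDiff.contDiffAt.comp z
    (h1.log (pow_ne_zero _ (norm_ne_zero_iff.2 h0)))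

end Hessian

/-- The Gram determinant of a vector `x` and vectors `v_i`, by a Schur complement. -/
theorem det_gram_cons {H : Type*} [NormedAddCommGroup H] [InnerProductSpace ℂ H] {x : H}
    (hx : x ≠ 0) (v : Fin n → H) :
    (Matrix.of fun a b => inner ℂ ((Fin.cons x v : Fin (n + 1) → H) a)
        ((Fin.cons x v : Fin (n + 1) → H) b)).det =
      inner ℂ x x ^ (n + 1) * (Matrix.of fun i j => (inner ℂ (v i) (v j) * inner ℂ x x -
        inner ℂ (v i) x * inner ℂ x (v j)) / inner ℂ x x ^ 2).det := by
  have hx' : inner ℂ x x ≠ 0 := inner_self_eq_zero.not.2 hx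
  set y : Fin (n + 1) → H := Fin.cons x v
  set T : Matrix (Fin n) (Fin n) ℂ := Matrix.of fun i j => (inner ℂ (v i) (v j) * inner ℂ x x -
        inner ℂ (v i) x * inner ℂ x (v j)) / inner ℂ x x ^ 2
  -- The multiples of row `0` whose subtraction clears column `0` below the first entry.
  set c : Fin (n + 1) → ℂ := Fin.cons 0 fun i => inner ℂ (v i) x / inner ℂ x x
  set B : Matrix (Fin (n + 1)) (Fin (n + 1)) ℂ :=
    Matrix.of fun a b => inner ℂ (y a) (y b) - c a * inner ℂ x (y b)
  have hB : (Matrix.of fun a b => inner ℂ (y a) (y b)).det = B.det := by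
    refine Matrix.det_eq_of_forall_row_eq_smul_add_const c 0 rfl fun a b => ?_
    simp [B, c, y]
  have hB0 : ∀ i : Fin n, B i.succ 0 = 0 := by
    intro i
    simp only [B, c, y, Matrix.of_apply, Fin.cons_succ, Fin.cons_zero]
    field_simp
    ring
  have hsub : B.submatrix (Fin.succAbove 0) Fin.succ = (inner ℂ x x) • T := by
    ext i j
    simp only [B, c, y, T, Matrix.submatrix_apply, Fin.succAbove_zero, Matrix.of_apply,
      Fin.cons_succ, Matrix.smul_apply, smul_eq_mul]
    field_simp
  rw [hB, Matrix.det_succ_column_zero, Fin.sum_univ_succ, Finset.sum_eq_zero, hsub,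
    Matrix.det_smul, Fintype.card_fin]
  · simp only [B, c, y, Matrix.of_apply, Fin.cons_zero, zero_mul, sub_zero]
    simp
    ring
  · intro i _
    rw [hB0]
    simp

/-! ### The Bergman metric and the tensor `T̃` in terms of a kernel model -/

section Model

open scoped ContDiff

theorem two_le_infty : (2 : WithTop ℕ∞) ≤ ∞ :=
  WithTop.coe_le_coe.2 (le_top (a := (2 : ℕ∞)))

variable {H : Type*} [NormedAddCommGroup H] [InnerProductSpace ℂ H]
  {Ω : Set (Fin n → ℂ)} {k : (Fin n → ℂ) → H}

theorem l2Inner_congr (hopen : IsOpen Ω) {f f' g g' : (Fin n → ℂ) → ℂ} (hf : EqOn f f' Ω)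
    (hg : EqOn g g' Ω) : l2Inner Ω f g = l2Inner Ω f' g' :=
  setIntegral_congr_fun hopen.measurableSet fun w hw => by simp only [hf hw, hg hw]

/-- The kernel is defined by choice, but any reproducing function comes from a vector of the model,
which the reproducing property forces to be `k z`. -/
theorem IsKernelModel.kernelDiag_eq (hk : IsKernelModel Ω k) (hopen : IsOpen Ω)
    {z : Fin n → ℂ} (hz : z ∈ Ω) : kernelDiag Ω z = ‖k z‖ ^ 2 := by
  have hex : ∃ k', IsReproducingAt Ω z k' := by
    refine ⟨fun w => inner ℂ (k w) (k z), hk.isL2Holomorphic _, fun f hf => ?_⟩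
    obtain ⟨g, hg⟩ := hk.exists_eq f hf
    rw [← hg z hz, ← hk.l2Inner_eq]
    exact l2Inner_congr hopen (fun w hw => hg w hw) (fun w _ => rfl)
  rw [kernelDiag, bergmanKernel, dif_pos hex]
  obtain ⟨h1, h2⟩ := hex.choose_spec
  obtain ⟨g', hg'⟩ := hk.exists_eq _ h1
  have : g' = k z := by
    refine ext_inner_right ℂ fun g => ?_
    have h3 : inner ℂ (k z) g = _ := h2 _ (hk.isL2Holomorphic g)
    rw [h3, ← hk.l2Inner_eq]
    exact l2Inner_congr hopen (fun w _ => rfl) (fun w hw => hg' w hw)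
  rw [← hg' z hz, this]
  exact inner_self_eq_norm_sq (𝕜 := ℂ) _

theorem IsKernelModel.isConjLinearAt (hk : IsKernelModel Ω k) (hopen : IsOpen Ω)
    {z : Fin n → ℂ} (hz : z ∈ Ω) : IsConjLinearAt k z := by
  intro Y
  rw [← add_eq_zero_iff_eq_neg]
  refine ext_inner_right ℂ fun g => ?_
  rw [inner_zero_left]
  exact (differentiableAt_inner_iff ((hk.contDiffAt z hz).differentiableAt (by simp)) g).1
    ((hk.isL2Holomorphic g).1.differentiableAt (hopen.mem_nhds hz)) Y

theorem isL2Holomorphic_of_bounded (hopen : IsOpen Ω) (hbdd : Bornology.IsBounded Ω)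
    {f : (Fin n → ℂ) → ℂ} (hf : Differentiable ℂ f) : IsL2Holomorphic Ω f := by
  have := isFiniteMeasure_restrict hbdd
  refine ⟨hf.differentiableOn, ?_⟩
  obtain ⟨C, hC⟩ := (hbdd.isCompact_closure.exists_bound_of_continuousOn
    hf.continuous.continuousOn)
  refine MemLp.of_bound hf.continuous.aestronglyMeasurable C ?_
  filter_upwards [ae_restrict_mem hopen.measurableSet] with w hw using hC w (subset_closure hw)

/-- The vector representing the evaluation at `z`, followed by those representing the partial
derivatives at `z`. -/
def kernelJet (k : (Fin n → ℂ) → H) (z : Fin n → ℂ) : Fin (n + 1) → H :=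
  Fin.cons (k z) fun i => fderiv ℝ k z (Pi.single i 1)

theorem IsKernelModel.contDiffAt_kernelJet (hk : IsKernelModel Ω k)
    {z : Fin n → ℂ} (hz : z ∈ Ω) (a : Fin (n + 1)) :
    ContDiffAt ℝ ∞ (fun w => kernelJet k w a) z := by
  refine Fin.cases ?_ (fun i => ?_) a
  · simpa [kernelJet] using hk.contDiffAt z hz
  · simpa [kernelJet] using
      ((hk.contDiffAt z hz).fderiv_right (m := ∞) (by simp)).clm_apply contDiffAt_const

theorem IsKernelModel.isConjLinearAt_kernelJet (hk : IsKernelModel Ω k) (hopen : IsOpen Ω)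
    {z : Fin n → ℂ} (hz : z ∈ Ω) (a : Fin (n + 1)) :
    IsConjLinearAt (fun w => kernelJet k w a) z := by
  refine Fin.cases ?_ (fun i => ?_) a
  · simpa [kernelJet] using hk.isConjLinearAt hopen hz
  · simpa [kernelJet] using isConjLinearAt_fderiv_apply ((hk.contDiffAt z hz).of_le two_le_infty)
      ((hopen.eventually_mem hz).mono fun w hw => hk.isConjLinearAt hopen hw) (Pi.single i 1)

variable {E : Type*} [NormedAddCommGroup E] [InnerProductSpace ℂ E]
  {W : ContinuousMultilinearMap ℂ (fun _ : Fin (n + 1) => H) E}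

theorem IsKernelModel.contDiffAt_wedge (hk : IsKernelModel Ω k) {z : Fin n → ℂ} (hz : z ∈ Ω) :
    ContDiffAt ℝ ∞ (fun w => W (kernelJet k w)) z :=
  (W.restrictScalars ℝ).contDiff.contDiffAt.comp z
    (contDiffAt_pi.2 (hk.contDiffAt_kernelJet hz))

theorem IsKernelModel.isConjLinearAt_wedge (hk : IsKernelModel Ω k) (hopen : IsOpen Ω)
    {z : Fin n → ℂ} (hz : z ∈ Ω) : IsConjLinearAt (fun w => W (kernelJet k w)) z := by
  intro Y
  have h := HasFDerivAt.multilinear_comp (W.restrictScalars ℝ) (x := z) fun a =>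
    ((hk.contDiffAt_kernelJet hz a).differentiableAt (by simp)).hasFDerivAt
  have h' : HasFDerivAt (fun w => W (kernelJet k w)) _ z := h
  rw [h'.fderiv]
  simp only [sum_apply, ContinuousLinearMap.comp_apply,
    fun a => hk.isConjLinearAt_kernelJet hopen hz a Y, map_neg, Finset.sum_neg_distrib,
    Finset.smul_sum]
  congr 1
  refine Finset.sum_congr rfl fun a _ => ?_
  exact W.map_update_smul _ _ _ _

/-- Entry by entry the jet matrix consists of the inner products of the kernel jet with the `g j`:
differentiating the evaluation formula represents the partial derivatives too. -/
theorem IsKernelModel.det_jetMatrix (hk : IsKernelModel Ω k) (hopen : IsOpen Ω)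
    (hW : IsWedge W) {z : Fin n → ℂ} (hz : z ∈ Ω) {f : Fin (n + 1) → (Fin n → ℂ) → ℂ}
    {g : Fin (n + 1) → H} (hfg : ∀ j, ∀ w ∈ Ω, inner ℂ (k w) (g j) = f j w) :
    (jetMatrix f z).det = inner ℂ (W (kernelJet k z)) (W g) := by
  rw [hW]
  congr 1
  ext a j
  have hd := differentiableAt_inner_const_and_fderiv ((hk.contDiffAt z hz).differentiableAt (by simp)) (g j)
  have heq : f j =ᶠ[𝓝 z] fun w => inner ℂ (k w) (g j) :=
    (hopen.eventually_mem hz).mono fun w hw => (hfg j w hw).symm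
  refine Fin.cases ?_ (fun i => ?_) a
  · simp [jetMatrix, kernelJet, hfg j z hz]
  · have hdC : DifferentiableAt ℂ (f j) z := heq.differentiableAt_iff.2
      ((hk.isL2Holomorphic (g j)).1.differentiableAt (hopen.mem_nhds hz))
    simp only [jetMatrix, kernelJet, Matrix.of_apply, Fin.cases_succ, Fin.cons_succ]
    rw [← hd.2, ← heq.fderiv_eq, hdC.fderiv_restrictScalars ℝ]
    rfl

/-- On a bounded domain the functions 1, z₁, …, zₙ are square-integrable. Their jet matrix is
triangular with unit diagonal, so a vanishing wedge would give 1 = 0. -/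
theorem IsKernelModel.wedge_ne_zero (hk : IsKernelModel Ω k) (hopen : IsOpen Ω)
    (hbdd : Bornology.IsBounded Ω) (hW : IsWedge W) {z : Fin n → ℂ} (hz : z ∈ Ω) :
    W (kernelJet k z) ≠ 0 := by
  set f : Fin (n + 1) → (Fin n → ℂ) → ℂ := Fin.cons (fun _ => 1) fun i w => w i with hf
  have hex : ∀ j, ∃ g, ∀ w ∈ Ω, inner ℂ (k w) g = f j w := by
    intro j
    refine hk.exists_eq _ (isL2Holomorphic_of_bounded hopen hbdd ?_)
    refine Fin.cases ?_ (fun i => ?_) j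
    · simp [f]
    · simp only [f, Fin.cons_succ]; fun_prop
  choose g hg using hex
  intro h0
  have h1 := hk.det_jetMatrix hopen hW hz hg
  have hder : ∀ i j : Fin n, fderiv ℂ (fun w : Fin n → ℂ => w j) z (Pi.single i 1) =
      if i = j then 1 else 0 := by
    intro i j
    have : HasFDerivAt (fun w : Fin n → ℂ => w j) (ContinuousLinearMap.proj (R := ℂ) j) z :=
      hasFDerivAt_apply j z
    rw [this.fderiv]
    simp [Pi.single_apply, eq_comm]
  have htri : (jetMatrix f z).BlockTriangular id := by
    intro a b hab
    induction a using Fin.cases with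
    | zero => exact absurd hab (Fin.not_lt_zero _)
    | succ i =>
      induction b using Fin.cases with
      | zero => simp [jetMatrix, f]
      | succ j =>
        have hij : i ≠ j := fun h => by simp [h] at hab
        simp [jetMatrix, f, hder, hij]
  rw [h0, inner_zero_left, Matrix.det_of_isUpperTriangular htri, Fin.prod_univ_succ] at h1
  simp [jetMatrix, f, hder] at h1

theorem IsKernelModel.ne_zero (hk : IsKernelModel Ω k) (hopen : IsOpen Ω)
    (hbdd : Bornology.IsBounded Ω) {z : Fin n → ℂ} (hz : z ∈ Ω) : k z ≠ 0 := by
  intro h0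
  obtain ⟨g, hg⟩ := hk.exists_eq (fun _ => 1) (isL2Holomorphic_of_bounded hopen hbdd (by fun_prop))
  have := hg z hz
  rw [h0, inner_zero_left] at this
  exact zero_ne_one this

theorem IsKernelModel.bergmanMetric_apply (hk : IsKernelModel Ω k) (hopen : IsOpen Ω)
    {z : Fin n → ℂ} (hz : z ∈ Ω) :
    bergmanMetric Ω z = complexHessian (fun w => Real.log (‖k w‖ ^ 2)) z :=
  complexHessian_congr ((hopen.eventually_mem hz).mono fun w hw => by
    simp only [hk.kernelDiag_eq hopen hw])

/-- Up to the factor ‖k z‖², T is the Schur complement of `k z` in the Gram matrix of the kernel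
jet. -/
theorem IsKernelModel.det_bergmanMetric (hk : IsKernelModel Ω k) (hopen : IsOpen Ω)
    (hbdd : Bornology.IsBounded Ω) (hW : IsWedge W) {z : Fin n → ℂ} (hz : z ∈ Ω) :
    kernelDiag Ω z ^ (n + 1) * bergmanDet Ω z = ‖W (kernelJet k z)‖ ^ 2 := by
  have h0 := hk.ne_zero hopen hbdd hz
  have h1 : bergmanMetric Ω z = Matrix.of fun i j =>
      (inner ℂ (fderiv ℝ k z (Pi.single i 1)) (fderiv ℝ k z (Pi.single j 1)) *
          inner ℂ (k z) (k z) - inner ℂ (fderiv ℝ k z (Pi.single i 1)) (k z) *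
          inner ℂ (k z) (fderiv ℝ k z (Pi.single j 1))) / inner ℂ (k z) (k z) ^ 2 := by
    ext i j
    rw [hk.bergmanMetric_apply hopen hz]
    exact complexHessian_log_norm_sq ((hk.contDiffAt z hz).of_le two_le_infty)
      ((hopen.eventually_mem hz).mono fun w hw => hk.isConjLinearAt hopen hw) h0 i j
  have h2 := hW.norm_sq (kernelJet k z)
  rw [kernelJet, det_gram_cons h0, ← h1] at h2
  have h3 : inner ℂ (k z) (k z) = ((kernelDiag Ω z : ℝ) : ℂ) := by
    rw [hk.kernelDiag_eq hopen hz, inner_self_eq_norm_sq_to_K]; norm_cast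
  rw [h3, ← Complex.ofReal_pow] at h2
  have h4 := congrArg Complex.re h2
  rw [Complex.re_ofReal_mul, Complex.ofReal_re] at h4
  exact h4.symm

/-- Since log det T = log ‖Φ‖² − (n + 1) log K with Φ the wedge of the kernel jet, the term (n + 1)
T in T̃ cancels the Hessian of the last summand. -/
theorem IsKernelModel.tildeMetric_eq (hk : IsKernelModel Ω k) (hopen : IsOpen Ω)
    (hbdd : Bornology.IsBounded Ω) (hW : IsWedge W) {z : Fin n → ℂ} (hz : z ∈ Ω) :
    tildeMetric Ω z = complexHessian (fun w => Real.log (‖W (kernelJet k w)‖ ^ 2)) z := by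
  have hev : (fun w => Real.log (bergmanDet Ω w)) =ᶠ[𝓝 z] fun w =>
      Real.log (‖W (kernelJet k w)‖ ^ 2) - ((n + 1 : ℕ) : ℝ) * Real.log (‖k w‖ ^ 2) := by
    filter_upwards [hopen.eventually_mem hz] with w hw
    have h1 : ‖k w‖ ^ 2 ≠ 0 := pow_ne_zero _ (norm_ne_zero_iff.2 (hk.ne_zero hopen hbdd hw))
    have h2 : ‖W (kernelJet k w)‖ ^ 2 ≠ 0 :=
      pow_ne_zero _ (norm_ne_zero_iff.2 (hk.wedge_ne_zero hopen hbdd hW hw))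
    have h3 := hk.det_bergmanMetric hopen hbdd hW hw
    rw [hk.kernelDiag_eq hopen hw] at h3
    have h4 : bergmanDet Ω w ≠ 0 := by
      rintro h
      rw [h, mul_zero] at h3
      exact h2 h3.symm
    rw [← h3, Real.log_mul (pow_ne_zero _ h1) h4, Real.log_pow]
    ring
  rw [tildeMetric, ricci, complexHessian_congr hev, complexHessian_sub_mul
    (contDiffAt_log_norm_sq ((hk.contDiffAt_wedge hz).of_le two_le_infty)
      (hk.wedge_ne_zero hopen hbdd hW hz))
    (contDiffAt_log_norm_sq ((hk.contDiffAt z hz).of_le two_le_infty) (hk.ne_zero hopen hbdd hz)),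
    hk.bergmanMetric_apply hopen hz]
  push_cast
  abel

theorem IsKernelModel.tildeLength_eq (hk : IsKernelModel Ω k) (hopen : IsOpen Ω)
    (hbdd : Bornology.IsBounded Ω) (hW : IsWedge W) {z : Fin n → ℂ} (hz : z ∈ Ω)
    (X : Fin n → ℂ) :
    tildeLength Ω z X = Real.sqrt (fsSq (W (kernelJet k z))
      (fderiv ℝ (fun w => W (kernelJet k w)) z X)) := by
  rw [tildeLength, hk.tildeMetric_eq hopen hbdd hW hz, sum_complexHessian_log_norm_sq
    ((hk.contDiffAt_wedge hz).of_le two_le_infty)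
    ((hopen.eventually_mem hz).mono fun w hw => hk.isConjLinearAt_wedge hopen hw)
    (hk.wedge_ne_zero hopen hbdd hW hz), Complex.ofReal_re]

end Model

/-! ### Projections to a moving line -/

section Projection

variable {E : Type*} [NormedAddCommGroup E] [InnerProductSpace ℂ E]

/-- The orthogonal projection of `v` to the line spanned by `x`. -/
def lineProj (x v : E) : E := (inner ℂ x v / inner ℂ x x) • x

theorem norm_lineProj_le (x v : E) : ‖lineProj x v‖ ≤ ‖v‖ := by
  rcases eq_or_ne x 0 with rfl | hx
  · simp [lineProj]
  have hx' : 0 < ‖x‖ := norm_pos_iff.2 hx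
  rw [lineProj, norm_smul, norm_div, inner_self_eq_norm_sq_to_K]
  simp only [norm_pow, Complex.coe_algebraMap, Complex.norm_real, norm_norm]
  rw [div_mul_eq_mul_div, div_le_iff₀ (by positivity)]
  have := norm_inner_le_norm (𝕜 := ℂ) x v
  nlinarith

theorem lineProj_sub (x v w : E) : lineProj x (v - w) = lineProj x v - lineProj x w := by
  rw [lineProj, lineProj, lineProj, inner_sub_right, sub_div, sub_smul]

theorem lineProj_lineProj (x v : E) : lineProj x (lineProj x v) = lineProj x v := by
  rcases eq_or_ne x 0 with rfl | hx
  · simp [lineProj]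
  have : inner ℂ x x ≠ 0 := inner_self_eq_zero.not.2 hx
  conv_lhs => rw [lineProj]
  conv_lhs => rw [lineProj, inner_smul_right, mul_div_assoc, div_self this, mul_one]
  rfl

theorem lineProj_self (x : E) : lineProj x x = x := by
  rcases eq_or_ne x 0 with rfl | hx
  · simp [lineProj]
  rw [lineProj, div_self (inner_self_eq_zero.not.2 hx), one_smul]

theorem norm_lineProj_sq (x v : E) : ‖lineProj x v‖ ^ 2 = ‖inner ℂ x v‖ ^ 2 / ‖x‖ ^ 2 := by
  rcases eq_or_ne x 0 with rfl | hx
  · simp [lineProj]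
  have hx' : ‖x‖ ≠ 0 := norm_ne_zero_iff.2 hx
  rw [lineProj, norm_smul, norm_div, inner_self_eq_norm_sq_to_K]
  simp only [norm_pow, Complex.coe_algebraMap, Complex.norm_real, norm_norm]
  field_simp

/-- The Fubini–Study length only sees the component of `y` orthogonal to `x`, relative to the size
of `x`. -/
theorem fsSq_eq {x : E} (hx : x ≠ 0) (y : E) :
    fsSq x y = (‖y - (inner ℂ x y / inner ℂ x x) • x‖ / ‖x‖) ^ 2 := by
  have hx' : ‖x‖ ≠ 0 := norm_ne_zero_iff.2 hx
  have hN : inner ℂ x x ≠ 0 := inner_self_eq_zero.not.2 hx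
  have h5 : ∀ x : E, ((‖x‖ ^ 2 : ℝ) : ℂ) = inner ℂ x x := fun x => by
    rw [inner_self_eq_norm_sq_to_K]; norm_cast
  have h4 : ((‖inner ℂ x y‖ ^ 2 : ℝ) : ℂ) = inner ℂ y x * inner ℂ x y := by
    rw [← inner_conj_symm y x, mul_comm, Complex.mul_conj, Complex.normSq_eq_norm_sq]
  have h6 : starRingEnd ℂ (inner ℂ x x) = inner ℂ x x := inner_conj_symm x x
  have key : ‖y - (inner ℂ x y / inner ℂ x x) • x‖ ^ 2 =
      (‖y‖ ^ 2 * ‖x‖ ^ 2 - ‖inner ℂ x y‖ ^ 2) / ‖x‖ ^ 2 := by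
    apply Complex.ofReal_injective
    rw [h5, Complex.ofReal_div, Complex.ofReal_sub, Complex.ofReal_mul, h5, h5, h4]
    simp only [inner_sub_left, inner_sub_right, inner_smul_left, inner_smul_right, map_div₀, h6,
      inner_conj_symm]
    field_simp
    ring
  rw [div_pow, key, fsSq]
  field_simp

/-- Moving `x` along its own line does not move the line, so only the component `q` of `y`
orthogonal to `x` enters the derivative. It enters in two terms, each at most ‖q‖‖v‖/‖x‖, whence the
constant 2. -/
theorem hasDerivWithinAt_lineProj {x : ℝ → E} {y : E} {s : Set ℝ} {t : ℝ}
    (h : HasDerivWithinAt x y s t) (h0 : x t ≠ 0) (v : E) :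
    ∃ p, HasDerivWithinAt (fun t => lineProj (x t) v) p s t ∧
      ‖p‖ ≤ 2 * Real.sqrt (fsSq (x t) y) * ‖v‖ := by
  have hN : inner ℂ (x t) (x t) ≠ 0 := inner_self_eq_zero.not.2 h0
  have hx' : 0 < ‖x t‖ := norm_pos_iff.2 h0
  refine ⟨_, ((h.inner ℂ (hasDerivWithinAt_const t s v)).div (h.inner ℂ h) hN).smul h, ?_⟩
  set q := y - (inner ℂ (x t) y / inner ℂ (x t) (x t)) • x t with hq
  have hy : y = q + (inner ℂ (x t) y / inner ℂ (x t) (x t)) • x t := by rw [hq]; abel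
  set α := inner ℂ (x t) y / inner ℂ (x t) (x t)
  have hqx : inner ℂ (x t) q = 0 := by
    rw [hq, inner_sub_right, inner_smul_right, div_mul_cancel₀ _ hN, sub_self]
  have hqx' : inner ℂ q (x t) = 0 := by rw [← inner_conj_symm, hqx, map_zero]
  have hsq : Real.sqrt (fsSq (x t) y) = ‖q‖ / ‖x t‖ := by
    rw [fsSq_eq h0, Real.sqrt_sq (by positivity)]
  have hp : ((inner ℂ (x t) v / inner ℂ (x t) (x t)) • y + (((inner ℂ (x t) 0 + inner ℂ y v) *
      inner ℂ (x t) (x t) - inner ℂ (x t) v * (inner ℂ (x t) y + inner ℂ y (x t))) /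
      inner ℂ (x t) (x t) ^ 2) • x t) =
      (inner ℂ (x t) v / inner ℂ (x t) (x t)) • q +
        (inner ℂ q v / inner ℂ (x t) (x t)) • x t := by
    rw [hy]
    simp only [inner_add_left, inner_add_right, inner_smul_left, inner_smul_right, hqx, hqx',
      inner_zero_right, smul_add, smul_smul, add_assoc, ← add_smul]
    congr 2
    field_simp
    ring
  have hn : ‖inner ℂ (x t) (x t)‖ = ‖x t‖ ^ 2 := by
    rw [inner_self_eq_norm_sq_to_K]; simp
  change ‖((inner ℂ (x t) v / inner ℂ (x t) (x t)) • y + (((inner ℂ (x t) 0 + inner ℂ y v) *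
      inner ℂ (x t) (x t) - inner ℂ (x t) v * (inner ℂ (x t) y + inner ℂ y (x t))) /
      inner ℂ (x t) (x t) ^ 2) • x t)‖ ≤ _
  rw [hp, hsq]
  refine (norm_add_le _ _).trans ?_
  rw [norm_smul, norm_smul, norm_div, norm_div, hn]
  have h1 : ‖inner ℂ (x t) v‖ / ‖x t‖ ^ 2 * ‖q‖ ≤ ‖x t‖ * ‖v‖ / ‖x t‖ ^ 2 * ‖q‖ := by
    gcongr; exact norm_inner_le_norm _ _
  have h2 : ‖inner ℂ q v‖ / ‖x t‖ ^ 2 * ‖x t‖ ≤ ‖q‖ * ‖v‖ / ‖x t‖ ^ 2 * ‖x t‖ := by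
    gcongr; exact norm_inner_le_norm _ _
  refine (add_le_add h1 h2).trans (le_of_eq ?_)
  field_simp
  ring

end Projection

/-! ### Curves -/

section Curves

variable {Ω : Set (Fin n → ℂ)} {z ζ ξ : Fin n → ℂ} {γ γ₁ γ₂ : ℝ → Fin n → ℂ}

/-- A relation between the end points of intervals holds for `0` and `1` if it holds for the `C¹`
pieces of a curve and is inherited by adjacent intervals. -/
theorem IsCurve.induction (hγ : IsCurve Ω z ζ γ) (P : ℝ → ℝ → Prop)
    (hpiece : ∀ a b, 0 ≤ a → a < b → b ≤ 1 → ContDiffOn ℝ 1 γ (Icc a b) → P a b)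
    (htrans : ∀ a b c, a ≤ b → b ≤ c → P a b → P b c → P a c) : P 0 1 := by
  obtain ⟨S, hS⟩ := hγ.piecewise
  -- Induction on the number of break points inside the interval.
  suffices h : ∀ (m : ℕ) (a b : ℝ), 0 ≤ a → a < b → b ≤ 1 →
      (S.filter fun t => t ∈ Ioo a b).card ≤ m → P a b from
    h _ 0 1 le_rfl zero_lt_one le_rfl le_rfl
  intro m
  induction m with
  | zero =>
    intro a b ha hab hb hm
    refine hpiece a b ha hab hb (hS a b ha hab hb fun t ht ht' => ?_)
    have : t ∈ S.filter fun t => t ∈ Ioo a b := Finset.mem_filter.2 ⟨ht, ht'⟩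
    rw [Finset.card_eq_zero.1 (Nat.le_zero.1 hm)] at this
    exact absurd this (Finset.notMem_empty t)
  | succ m ih =>
    intro a b ha hab hb hm
    by_cases hex : ∃ t ∈ S, t ∈ Ioo a b
    · obtain ⟨t, ht, hta, htb⟩ := hex
      have htS : t ∈ S.filter fun t => t ∈ Ioo a b := Finset.mem_filter.2 ⟨ht, hta, htb⟩
      have hlt : ∀ c d, Ioo c d ⊆ Ioo a b → t ∉ Ioo c d →
          (S.filter fun t => t ∈ Ioo c d).card ≤ m := by
        intro c d hcd htcd
        have : (S.filter fun t => t ∈ Ioo c d) ⊂ S.filter fun t => t ∈ Ioo a b := by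
          refine Finset.ssubset_iff_of_subset (fun u hu => ?_) |>.2 ⟨t, htS, fun h => ?_⟩
          · rw [Finset.mem_filter] at hu ⊢
            exact ⟨hu.1, hcd hu.2⟩
          · exact htcd (Finset.mem_filter.1 h).2
        have := Finset.card_lt_card this
        omega
      refine htrans a t b hta.le htb.le (ih a t ha hta (htb.le.trans hb) ?_)
        (ih t b (ha.trans hta.le) htb hb ?_)
      · exact hlt a t (Ioo_subset_Ioo_right htb.le) fun h => lt_irrefl _ h.2
      · exact hlt t b (Ioo_subset_Ioo_left hta.le) fun h => lt_irrefl _ h.1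
    · push Not at hex
      exact hpiece a b ha hab hb (hS a b ha hab hb hex)

/-- The length of a curve. -/
def curveLength (Ω : Set (Fin n → ℂ)) (γ : ℝ → Fin n → ℂ) : ℝ :=
  ∫ t in (0 : ℝ)..1, tildeLength Ω (γ t) (deriv γ t)

theorem tildeLength_nonneg (w X : Fin n → ℂ) : 0 ≤ tildeLength Ω w X := Real.sqrt_nonneg _

theorem curveLength_nonneg : 0 ≤ curveLength Ω γ :=
  intervalIntegral.integral_nonneg zero_le_one fun _ _ => tildeLength_nonneg _ _

theorem bddBelow_curveLength :
    BddBelow {L : ℝ | ∃ γ, IsCurve Ω z ζ γ ∧ L = ∫ t in (0 : ℝ)..1,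
      tildeLength Ω (γ t) (deriv γ t)} :=
  ⟨0, by rintro _ ⟨γ, -, rfl⟩; exact curveLength_nonneg⟩

theorem tildeDist_nonneg : 0 ≤ tildeDist Ω z ζ :=
  Real.sInf_nonneg (by rintro _ ⟨γ, -, rfl⟩; exact curveLength_nonneg)

theorem IsCurve.tildeDist_le (hγ : IsCurve Ω z ζ γ) : tildeDist Ω z ζ ≤ curveLength Ω γ :=
  csInf_le bddBelow_curveLength ⟨γ, hγ, rfl⟩

/-- Existence of some curve must be assumed: the infimum of the empty set is 0 by convention. -/
theorem exists_curve_of_tildeDist_lt (h : ∃ γ, IsCurve Ω z ζ γ) {c : ℝ}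
    (hc : tildeDist Ω z ζ < c) : ∃ γ, IsCurve Ω z ζ γ ∧ curveLength Ω γ < c := by
  obtain ⟨γ, hγ⟩ := h
  obtain ⟨_, ⟨γ', hγ', rfl⟩, hlt⟩ := exists_lt_of_csInf_lt (s := {L : ℝ | ∃ γ, IsCurve Ω z ζ γ ∧
    L = ∫ t in (0 : ℝ)..1, tildeLength Ω (γ t) (deriv γ t)}) ⟨_, γ, hγ, rfl⟩ hc
  exact ⟨γ', hγ', hlt⟩

theorem tildeLength_smul (w X : Fin n → ℂ) (c : ℝ) :
    tildeLength Ω w (c • X) = |c| * tildeLength Ω w X := by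
  have : (∑ i, ∑ j, tildeMetric Ω w i j * (c • X) i * starRingEnd ℂ ((c • X) j)) =
      ((c ^ 2 : ℝ) : ℂ) * ∑ i, ∑ j, tildeMetric Ω w i j * X i * starRingEnd ℂ (X j) := by
    rw [Finset.mul_sum]
    refine Finset.sum_congr rfl fun i _ => ?_
    rw [Finset.mul_sum]
    refine Finset.sum_congr rfl fun j _ => ?_
    simp only [Pi.smul_apply, Complex.real_smul, map_mul, Complex.conj_ofReal]
    push_cast
    ring
  rw [tildeLength, this, Complex.re_ofReal_mul, Real.sqrt_mul (sq_nonneg c), Real.sqrt_sq_eq_abs]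
  rfl

/-- The curve `γ₁` followed by the curve `γ₂`. -/
def concat (γ₁ γ₂ : ℝ → Fin n → ℂ) (t : ℝ) : Fin n → ℂ :=
  if t ≤ 1 / 2 then γ₁ (2 * t) else γ₂ (2 * t - 1)

theorem eqOn_concat_left : EqOn (concat γ₁ γ₂) (fun t => γ₁ (2 * t)) (Iic (1 / 2)) :=
  fun _ ht => if_pos ht

theorem eqOn_concat_right (h : γ₁ 1 = γ₂ 0) :
    EqOn (concat γ₁ γ₂) (fun t => γ₂ (2 * t - 1)) (Ici (1 / 2)) := by
  intro t ht
  rcases eq_or_lt_of_le (mem_Ici.1 ht) with rfl | h'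
  · norm_num [concat, h]
  · exact if_neg (not_le.2 h')

theorem IsCurve.concat (h₁ : IsCurve Ω z ζ γ₁) (h₂ : IsCurve Ω ζ ξ γ₂) :
    IsCurve Ω z ξ (concat γ₁ γ₂) where
  continuousOn := by
    have hI : Icc (0 : ℝ) 1 = Icc 0 (1 / 2) ∪ Icc (1 / 2) 1 :=
      (Icc_union_Icc_eq_Icc (by norm_num) (by norm_num)).symm
    rw [hI]
    refine ContinuousOn.union_of_isClosed ?_ ?_ isClosed_Icc isClosed_Icc
    · refine ContinuousOn.congr ?_ (eqOn_concat_left.mono Icc_subset_Iic_self)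
      refine h₁.continuousOn.comp (by fun_prop) fun t ht => ?_
      constructor <;> linarith [ht.1, ht.2]
    · refine ContinuousOn.congr ?_
        ((eqOn_concat_right (h₁.target.trans h₂.source.symm)).mono Icc_subset_Ici_self)
      refine h₂.continuousOn.comp (by fun_prop) fun t ht => ?_
      constructor <;> linarith [ht.1, ht.2]
  piecewise := by
    obtain ⟨S₁, hS₁⟩ := h₁.piecewise
    obtain ⟨S₂, hS₂⟩ := h₂.piecewise
    refine ⟨insert (1 / 2) (S₁.image (fun t => t / 2) ∪ S₂.image fun t => (t + 1) / 2),
      fun a b ha hab hb hS => ?_⟩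
    have hhalf := hS (1 / 2) (Finset.mem_insert_self _ _)
    rcases le_or_gt b (1 / 2) with hb' | hb'
    · refine ContDiffOn.congr ?_ (eqOn_concat_left.mono fun t ht => ht.2.trans hb')
      refine (hS₁ (2 * a) (2 * b) (by linarith) (by linarith) (by linarith) ?_).comp
        (by fun_prop) fun t ht => ?_
      · intro t ht ht'
        refine hS (t / 2) (Finset.mem_insert_of_mem (Finset.mem_union_left _
          (Finset.mem_image_of_mem _ ht))) ?_
        constructor <;> linarith [ht'.1, ht'.2]
      · constructor <;> linarith [ht.1, ht.2]
    · have ha' : 1 / 2 ≤ a := by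
        by_contra! h
        exact hhalf ⟨h, hb'⟩
      refine ContDiffOn.congr ?_ ((eqOn_concat_right (h₁.target.trans h₂.source.symm)).mono
        fun t ht => ha'.trans ht.1)
      refine (hS₂ (2 * a - 1) (2 * b - 1) (by linarith) (by linarith) (by linarith) ?_).comp
        (by fun_prop) fun t ht => ?_
      · intro t ht ht'
        refine hS ((t + 1) / 2) (Finset.mem_insert_of_mem (Finset.mem_union_right _
          (Finset.mem_image_of_mem (fun t => (t + 1) / 2) ht))) ?_
        constructor <;> linarith [ht'.1, ht'.2]
      · constructor <;> linarith [ht.1, ht.2]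
  mapsTo := by
    intro t ht
    rcases le_total t (1 / 2) with h | h
    · rw [eqOn_concat_left h]
      exact h₁.mapsTo ⟨by linarith [ht.1], by linarith⟩
    · rw [eqOn_concat_right (h₁.target.trans h₂.source.symm) h]
      exact h₂.mapsTo ⟨by linarith, by linarith [ht.2]⟩
  source := by
    rw [eqOn_concat_left (by norm_num : (0 : ℝ) ∈ Iic (1 / 2))]
    simpa using h₁.source
  target := by
    rw [eqOn_concat_right (h₁.target.trans h₂.source.symm)
      (by norm_num : (1 : ℝ) ∈ Ici (1 / 2))]
    norm_num [h₂.target]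

/-- At the end points of a piece the two-sided `deriv` may take its default value; only the open
interval matters for the length. -/
theorem integral_congr_Ioo {f g : ℝ → ℝ} {a b : ℝ} (hab : a ≤ b) (h : EqOn f g (Ioo a b)) :
    ∫ t in a..b, f t = ∫ t in a..b, g t := by
  rw [intervalIntegral.integral_of_le hab, intervalIntegral.integral_of_le hab,
    integral_Ioc_eq_integral_Ioo, integral_Ioc_eq_integral_Ioo]
  exact setIntegral_congr_fun measurableSet_Ioo h

/-- Each half runs at double speed, and homogeneity of the length cancels this. Integrability is
required to split the integral. -/
theorem curveLength_concat (h : γ₁ 1 = γ₂ 0)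
    (hint : IntervalIntegrable
      (fun t => tildeLength Ω (concat γ₁ γ₂ t) (deriv (concat γ₁ γ₂) t)) volume 0 1) :
    curveLength Ω (concat γ₁ γ₂) = curveLength Ω γ₁ + curveLength Ω γ₂ := by
  have e1 : ∫ t in (0 : ℝ)..(1 / 2),
      tildeLength Ω (concat γ₁ γ₂ t) (deriv (concat γ₁ γ₂) t) = curveLength Ω γ₁ := by
    have : EqOn (fun t => tildeLength Ω (concat γ₁ γ₂ t) (deriv (concat γ₁ γ₂) t))
        (fun t => 2 * (fun s => tildeLength Ω (γ₁ s) (deriv γ₁ s)) (2 * t))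
        (Ioo 0 (1 / 2)) := by
      intro t ht
      have hev : concat γ₁ γ₂ =ᶠ[𝓝 t] fun t => γ₁ (2 * t) :=
        (eqOn_concat_left.mono Iio_subset_Iic_self).eventuallyEq_of_mem (Iio_mem_nhds ht.2)
      simp only [hev.deriv_eq, hev.eq_of_nhds, deriv_comp_mul_left, tildeLength_smul]
      norm_num
    rw [integral_congr_Ioo (by norm_num) this, intervalIntegral.integral_const_mul,
      intervalIntegral.mul_integral_comp_mul_left (c := 2)
        (f := fun s => tildeLength Ω (γ₁ s) (deriv γ₁ s))]
    norm_num [curveLength]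
  have e2 : ∫ t in (1 / 2 : ℝ)..1,
      tildeLength Ω (concat γ₁ γ₂ t) (deriv (concat γ₁ γ₂) t) = curveLength Ω γ₂ := by
    have : EqOn (fun t => tildeLength Ω (concat γ₁ γ₂ t) (deriv (concat γ₁ γ₂) t))
        (fun t => 2 * (fun s => tildeLength Ω (γ₂ s) (deriv γ₂ s)) (2 * t - 1))
        (Ioo (1 / 2) 1) := by
      intro t ht
      have hev : concat γ₁ γ₂ =ᶠ[𝓝 t] fun t => γ₂ (2 * t - 1) :=
        ((eqOn_concat_right h).mono Ioi_subset_Ici_self).eventuallyEq_of_mem (Ioi_mem_nhds ht.1)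
      have hd : deriv (fun t => γ₂ (2 * t - 1)) t = (2 : ℝ) • deriv γ₂ (2 * t - 1) := by
        rw [deriv_comp_mul_left 2 (fun s => γ₂ (s - 1)), deriv_comp_sub_const]
      simp only [hev.deriv_eq, hev.eq_of_nhds, hd, tildeLength_smul]
      norm_num
    rw [integral_congr_Ioo (by norm_num) this, intervalIntegral.integral_const_mul,
      intervalIntegral.mul_integral_comp_mul_sub (c := 2) (d := 1)
        (f := fun s => tildeLength Ω (γ₂ s) (deriv γ₂ s))]
    norm_num [curveLength]
  have hsub : ∀ c d : ℝ, c ∈ Icc (0 : ℝ) 1 → d ∈ Icc (0 : ℝ) 1 → IntervalIntegrable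
      (fun t => tildeLength Ω (concat γ₁ γ₂ t) (deriv (concat γ₁ γ₂) t)) volume c d := by
    intro c d hc hd
    refine hint.mono_set ?_
    rw [uIcc_of_le zero_le_one]
    exact uIcc_subset_Icc hc hd
  rw [curveLength, ← intervalIntegral.integral_add_adjacent_intervals
    (hsub 0 (1 / 2) (by norm_num) (by norm_num)) (hsub (1 / 2) 1 (by norm_num) (by norm_num)),
    e1, e2]

theorem isCurve_lineMap {s : Set (Fin n → ℂ)} (hs : Convex ℝ s) (hsΩ : s ⊆ Ω) (hz : z ∈ s)
    (hζ : ζ ∈ s) : IsCurve Ω z ζ (AffineMap.lineMap z ζ) where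
  continuousOn := AffineMap.lineMap_continuous.continuousOn
  piecewise := ⟨∅, fun a b _ _ _ _ => by
    have : ContDiff ℝ 1 (fun t : ℝ => AffineMap.lineMap z ζ t) := by
      simp only [AffineMap.lineMap_apply_module]
      fun_prop
    exact this.contDiffOn⟩
  mapsTo := fun t ht => hsΩ (hs.lineMap_mem hz hζ ht)
  source := AffineMap.lineMap_apply_zero _ _
  target := AffineMap.lineMap_apply_one _ _

theorem exists_isCurve (hopen : IsOpen Ω) (hconn : IsConnected Ω) (hz : z ∈ Ω) (hζ : ζ ∈ Ω) :
    ∃ γ, IsCurve Ω z ζ γ := by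
  refine hconn.isPreconnected.induction₂' (fun z ζ => ∃ γ, IsCurve Ω z ζ γ) (fun x hx => ?_)
    (fun x y w _ _ _ h1 h2 => ?_) hz hζ
  · obtain ⟨r, hr, hball⟩ := Metric.isOpen_iff.1 hopen x hx
    filter_upwards [mem_nhdsWithin_of_mem_nhds (Metric.ball_mem_nhds x hr)] with y hy
    exact ⟨⟨_, isCurve_lineMap (convex_ball x r) hball (Metric.mem_ball_self hr) hy⟩,
      ⟨_, isCurve_lineMap (convex_ball x r) hball hy (Metric.mem_ball_self hr)⟩⟩
  · obtain ⟨γ₁, h1⟩ := h1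
    obtain ⟨γ₂, h2⟩ := h2
    exact ⟨_, h1.concat h2⟩

end Curves

/-! ### Curves and the Fubini–Study length -/

section Length

variable {E : Type*} [NormedAddCommGroup E] [InnerProductSpace ℂ E]
  {Ω : Set (Fin n → ℂ)} {Φ : (Fin n → ℂ) → E} {z ζ ξ : Fin n → ℂ} {γ : ℝ → Fin n → ℂ}

/-- The length of `T̃` is the pullback of the Fubini–Study length under `Φ`. -/
structure IsFubiniStudyMap (Ω : Set (Fin n → ℂ)) (Φ : (Fin n → ℂ) → E) : Prop where
  contDiffAt : ∀ z ∈ Ω, ContDiffAt ℝ 2 Φ z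
  ne_zero : ∀ z ∈ Ω, Φ z ≠ 0
  tildeLength_eq : ∀ z ∈ Ω, ∀ X, tildeLength Ω z X = Real.sqrt (fsSq (Φ z) (fderiv ℝ Φ z X))

/-- On a C¹ piece the one-sided derivative is continuous up to the end points. So the speed is
integrable, and the derivative bound for the projections can be integrated. -/
theorem IsFubiniStudyMap.intervalIntegrable_and_norm_sub_le (hΦ : IsFubiniStudyMap Ω Φ) {a b : ℝ}
    (hab : a < b) (hγ : ContDiffOn ℝ 1 γ (Icc a b)) (hmaps : MapsTo γ (Icc a b) Ω) (v : E) :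
    IntervalIntegrable (fun t => tildeLength Ω (γ t) (deriv γ t)) volume a b ∧
      ‖lineProj (Φ (γ b)) v - lineProj (Φ (γ a)) v‖ ≤
        2 * (∫ t in a..b, tildeLength Ω (γ t) (deriv γ t)) * ‖v‖ := by
  set G := derivWithin γ (Icc a b)
  set D : ℝ → E := fun t => fderiv ℝ Φ (γ t) (G t)
  have hG : ContinuousOn G (Icc a b) := hγ.continuousOn_derivWithin (uniqueDiffOn_Icc hab) le_rfl
  have hx : ContinuousOn (fun t => Φ (γ t)) (Icc a b) := fun t ht =>
    (hΦ.contDiffAt _ (hmaps ht)).continuousAt.comp_continuousWithinAt (hγ.continuousOn t ht)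
  have hD : ContinuousOn D (Icc a b) := by
    refine ContinuousOn.clm_apply (fun t ht => ?_) hG
    exact ((hΦ.contDiffAt _ (hmaps ht)).fderiv_right (m := 1)
      (by norm_num)).continuousAt.comp_continuousWithinAt (hγ.continuousOn t ht)
  set ℓ : ℝ → ℝ := fun t => Real.sqrt (fsSq (Φ (γ t)) (D t))
  have hℓ : ContinuousOn ℓ (Icc a b) := by
    refine ContinuousOn.sqrt (ContinuousOn.div ?_ (hx.norm.pow 4) fun t ht =>
      pow_ne_zero _ (norm_ne_zero_iff.2 (hΦ.ne_zero _ (hmaps ht))))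
    exact ((hD.norm.pow 2).mul (hx.norm.pow 2)).sub ((ContinuousOn.inner (𝕜 := ℂ) hx hD).norm.pow 2)
  have hEq : EqOn (fun t => tildeLength Ω (γ t) (deriv γ t)) ℓ (Ioo a b) := by
    intro t ht
    have : deriv γ t = G t := (derivWithin_of_mem_nhds (Icc_mem_nhds ht.1 ht.2)).symm
    simp only [this, hΦ.tildeLength_eq _ (hmaps (Ioo_subset_Icc_self ht)), ℓ, D]
  have hint : IntervalIntegrable ℓ volume a b := hℓ.intervalIntegrable_of_Icc hab.le
  refine ⟨?_, ?_⟩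
  · rw [intervalIntegrable_iff_integrableOn_Ioo_of_le hab.le] at hint ⊢
    exact hint.congr_fun hEq.symm measurableSet_Ioo
  rw [integral_congr_Ioo hab.le hEq]
  -- A continuous extension to the whole line makes the bounding primitive differentiable
  -- everywhere.
  set ℓ' : ℝ → ℝ := IccExtend hab.le ((Icc a b).domRestrict ℓ)
  have hℓ' : Continuous ℓ' := (continuousOn_iff_continuous_domRestrict.1 hℓ).Icc_extend'
  have hℓEq : EqOn ℓ' ℓ (Icc a b) := fun t ht => IccExtend_of_mem _ _ ht
  have hBd : ∀ t, HasDerivAt (fun t => 2 * (∫ s in a..t, ℓ' s) * ‖v‖) (2 * ℓ' t * ‖v‖) t :=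
    fun t => ((hℓ'.integral_hasStrictDerivAt a t).hasDerivAt.const_mul 2).mul_const _
  have hder : ∀ t ∈ Icc a b, ∃ p, HasDerivWithinAt (fun t => lineProj (Φ (γ t)) v) p (Icc a b) t ∧
      ‖p‖ ≤ 2 * ℓ' t * ‖v‖ := by
    intro t ht
    have h1 : HasDerivWithinAt γ (G t) (Icc a b) t :=
      (hγ.differentiableOn one_ne_zero t ht).hasDerivWithinAt
    have h2 : HasDerivWithinAt (fun t => Φ (γ t)) (D t) (Icc a b) t :=
      (((hΦ.contDiffAt _ (hmaps ht)).differentiableAt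
        (by norm_num)).hasFDerivAt).comp_hasDerivWithinAt t h1
    rw [hℓEq ht]
    exact hasDerivWithinAt_lineProj h2 (hΦ.ne_zero _ (hmaps ht)) v
  choose! p hp hpn using hder
  have hfin := image_norm_le_of_norm_deriv_right_le_deriv_boundary (a := a) (b := b)
    (f := fun t => lineProj (Φ (γ t)) v - lineProj (Φ (γ a)) v) (f' := p)
    (B := fun t => 2 * (∫ s in a..t, ℓ' s) * ‖v‖) (B' := fun t => 2 * ℓ' t * ‖v‖)
    (fun t ht => (hp t ht).continuousWithinAt.sub continuousWithinAt_const)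
    (fun t ht => by
      refine ((hp t (Ico_subset_Icc_self ht)).mono_of_mem_nhdsWithin ?_).sub_const _
      exact Icc_mem_nhdsGE_of_mem ht)
    (by simp) hBd (fun t ht => hpn t (Ico_subset_Icc_self ht)) (right_mem_Icc.2 hab.le)
  refine hfin.trans (le_of_eq ?_)
  congr 2
  refine intervalIntegral.integral_congr fun t ht => ?_
  rw [uIcc_of_le hab.le] at ht
  exact hℓEq ht

theorem IsFubiniStudyMap.curve (hΦ : IsFubiniStudyMap Ω Φ) (hγ : IsCurve Ω z ζ γ) (v : E) :
    IntervalIntegrable (fun t => tildeLength Ω (γ t) (deriv γ t)) volume 0 1 ∧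
      ‖lineProj (Φ ζ) v - lineProj (Φ z) v‖ ≤ 2 * curveLength Ω γ * ‖v‖ := by
  rw [← hγ.source, ← hγ.target]
  refine hγ.induction (fun a b => IntervalIntegrable
      (fun t => tildeLength Ω (γ t) (deriv γ t)) volume a b ∧
    ‖lineProj (Φ (γ b)) v - lineProj (Φ (γ a)) v‖ ≤
        2 * (∫ t in a..b, tildeLength Ω (γ t) (deriv γ t)) * ‖v‖) ?_ ?_
  · intro a b ha hab hb h
    exact hΦ.intervalIntegrable_and_norm_sub_le hab h
      (hγ.mapsTo.mono_left (Icc_subset_Icc ha hb)) v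
  · rintro a b c - - ⟨h1, h2⟩ ⟨h3, h4⟩
    refine ⟨h1.trans h3, ?_⟩
    rw [← intervalIntegral.integral_add_adjacent_intervals h1 h3,
      ← sub_add_sub_cancel' (lineProj (Φ (γ b)) v) (lineProj (Φ (γ a)) v)]
    refine (norm_add_le _ _).trans ((add_le_add h2 h4).trans (le_of_eq ?_))
    ring

theorem IsFubiniStudyMap.norm_lineProj_sub_le (hΦ : IsFubiniStudyMap Ω Φ) (hopen : IsOpen Ω)
    (hconn : IsConnected Ω) (hz : z ∈ Ω) (hζ : ζ ∈ Ω) (v : E) :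
    ‖lineProj (Φ ζ) v - lineProj (Φ z) v‖ ≤ 2 * tildeDist Ω z ζ * ‖v‖ := by
  have h : ∀ ε > 0, ‖lineProj (Φ ζ) v - lineProj (Φ z) v‖ ≤ 2 * (tildeDist Ω z ζ + ε) * ‖v‖ := by
    intro ε hε
    obtain ⟨γ, hγ, hlt⟩ := exists_curve_of_tildeDist_lt (exists_isCurve hopen hconn hz hζ)
      (lt_add_of_pos_right (tildeDist Ω z ζ) hε)
    refine (hΦ.curve hγ v).2.trans ?_
    gcongr
  have hlim : Tendsto (fun ε : ℝ => 2 * (tildeDist Ω z ζ + ε) * ‖v‖) (𝓝[>] 0)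
      (𝓝 (2 * (tildeDist Ω z ζ + 0) * ‖v‖)) :=
    (Continuous.tendsto (by fun_prop) 0).mono_left nhdsWithin_le_nhds
  rw [add_zero] at hlim
  exact ge_of_tendsto hlim (eventually_mem_nhdsWithin.mono h)

theorem IsFubiniStudyMap.tildeDist_triangle (hΦ : IsFubiniStudyMap Ω Φ) (hopen : IsOpen Ω)
    (hconn : IsConnected Ω) (hz : z ∈ Ω) (hζ : ζ ∈ Ω) (hξ : ξ ∈ Ω) :
    tildeDist Ω z ξ ≤ tildeDist Ω z ζ + tildeDist Ω ζ ξ := by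
  refine le_of_forall_pos_lt_add fun ε hε => ?_
  obtain ⟨γ₁, h₁, hlt₁⟩ := exists_curve_of_tildeDist_lt (exists_isCurve hopen hconn hz hζ)
    (lt_add_of_pos_right (tildeDist Ω z ζ) (half_pos hε))
  obtain ⟨γ₂, h₂, hlt₂⟩ := exists_curve_of_tildeDist_lt (exists_isCurve hopen hconn hζ hξ)
    (lt_add_of_pos_right (tildeDist Ω ζ ξ) (half_pos hε))
  have h := (h₁.concat h₂).tildeDist_le
  -- The vector `0` is a dummy; only the integrability statement is used.
  rw [curveLength_concat (h₁.target.trans h₂.source.symm) (hΦ.curve (h₁.concat h₂) 0).1] at h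
  linarith

/-- Near `p` the T̃-length is at most a constant times the norm, so straight segments to `p` are
short. -/
theorem IsFubiniStudyMap.tendsto_tildeDist (hΦ : IsFubiniStudyMap Ω Φ) (hopen : IsOpen Ω)
    {p : Fin n → ℂ} (hp : p ∈ Ω) : Tendsto (fun z => tildeDist Ω z p) (𝓝 p) (𝓝 0) := by
  set C := ‖fderiv ℝ Φ p‖ / ‖Φ p‖ + 1
  have hcont : ContinuousAt (fun w => ‖fderiv ℝ Φ w‖ / ‖Φ w‖) p :=
    ((hΦ.contDiffAt p hp).fderiv_right (m := 1) (by norm_num)).continuousAt.norm.div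
      (hΦ.contDiffAt p hp).continuousAt.norm (norm_ne_zero_iff.2 (hΦ.ne_zero p hp))
  have hev : ∀ᶠ w in 𝓝 p, w ∈ Ω ∧ ‖fderiv ℝ Φ w‖ / ‖Φ w‖ < C :=
    (hopen.eventually_mem hp).and (hcont.eventually_lt_const (lt_add_one _))
  obtain ⟨r, hr, hball⟩ := Metric.eventually_nhds_iff_ball.1 hev
  have hlen : ∀ w ∈ Metric.ball p r, ∀ X, tildeLength Ω w X ≤ C * ‖X‖ := by
    intro w hw X
    rw [hΦ.tildeLength_eq w (hball w hw).1]
    have h0 : 0 < ‖Φ w‖ := norm_pos_iff.2 (hΦ.ne_zero w (hball w hw).1)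
    refine (Real.sqrt_le_sqrt (fsSq_le _)).trans ?_
    rw [Real.sqrt_sq (by positivity)]
    calc ‖fderiv ℝ Φ w X‖ / ‖Φ w‖ ≤ ‖fderiv ℝ Φ w‖ * ‖X‖ / ‖Φ w‖ := by
          gcongr; exact ContinuousLinearMap.le_opNorm _ _
      _ = ‖fderiv ℝ Φ w‖ / ‖Φ w‖ * ‖X‖ := by ring
      _ ≤ C * ‖X‖ := by gcongr; exact (hball w hw).2.le
  have hlim : Tendsto (fun z => C * ‖p - z‖) (𝓝 p) (𝓝 0) := by
    have : Continuous fun z => C * ‖p - z‖ := by fun_prop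
    simpa using this.tendsto p
  refine squeeze_zero' (Eventually.of_forall fun _ => tildeDist_nonneg) ?_ hlim
  filter_upwards [Metric.ball_mem_nhds p hr] with z hz
  have hc := isCurve_lineMap (convex_ball p r) (fun w hw => (hball w hw).1) hz
    (Metric.mem_ball_self hr)
  refine hc.tildeDist_le.trans ((le_abs_self _).trans ?_)
  have := intervalIntegral.norm_integral_le_of_norm_le_const (a := 0) (b := 1) (C := C * ‖p - z‖)
    (f := fun t : ℝ => tildeLength Ω (AffineMap.lineMap z p t)
      (deriv (fun t : ℝ => AffineMap.lineMap z p t) t)) (fun t ht => by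
      rw [uIoc_of_le zero_le_one] at ht
      rw [Real.norm_of_nonneg (tildeLength_nonneg _ _), AffineMap.hasDerivAt_lineMap.deriv]
      exact hlen _ ((convex_ball p r).lineMap_mem hz (Metric.mem_ball_self hr)
        ⟨ht.1.le, ht.2⟩) _)
  simpa [curveLength] using this

end Length

/-! ### The completeness criterion -/

section Completeness

variable {H E : Type*} [NormedAddCommGroup H] [InnerProductSpace ℂ H]
  [NormedAddCommGroup E] [InnerProductSpace ℂ E]
  {Ω : Set (Fin n → ℂ)} {k : (Fin n → ℂ) → H}
  {W : ContinuousMultilinearMap ℂ (fun _ : Fin (n + 1) => H) E}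

theorem IsKernelModel.isFubiniStudyMap (hk : IsKernelModel Ω k) (hopen : IsOpen Ω)
    (hbdd : Bornology.IsBounded Ω) (hW : IsWedge W) :
    IsFubiniStudyMap Ω fun z => W (kernelJet k z) where
  contDiffAt _ hz := (hk.contDiffAt_wedge hz).of_le two_le_infty
  ne_zero _ hz := hk.wedge_ne_zero hopen hbdd hW hz
  tildeLength_eq _ hz X := hk.tildeLength_eq hopen hbdd hW hz X

variable [CompleteSpace E]

/-- Along a Cauchy sequence the lines spanned by the values of a Fubini–Study map converge. -/
theorem IsFubiniStudyMap.exists_tendsto_lineProj {Φ : (Fin n → ℂ) → E}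
    (hΦ : IsFubiniStudyMap Ω Φ) (hopen : IsOpen Ω) (hconn : IsConnected Ω)
    {u : ℕ → Fin n → ℂ} (hu : ∀ m, u m ∈ Ω)
    (hcauchy : ∀ ε > 0, ∃ N, ∀ k ≥ N, ∀ l ≥ N, tildeDist Ω (u k) (u l) < ε) :
    ∃ v ω : E, ω ≠ 0 ∧ Tendsto (fun m => lineProj (Φ (u m)) v) atTop (𝓝 ω) ∧
      Tendsto (fun m => lineProj (Φ (u m)) ω) atTop (𝓝 ω) := by
  -- With the Lipschitz factor 2, the bound 1/4 keeps the later projections of `v` within ‖v‖/2 of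
  -- `v`, so their limit cannot vanish.
  obtain ⟨K, hK⟩ := hcauchy (1 / 4) (by norm_num)
  set v := Φ (u K)
  have hv : 0 < ‖v‖ := norm_pos_iff.2 (hΦ.ne_zero _ (hu K))
  have hle : ∀ m l, ‖lineProj (Φ (u l)) v - lineProj (Φ (u m)) v‖ ≤
      2 * tildeDist Ω (u m) (u l) * ‖v‖ := fun m l =>
    hΦ.norm_lineProj_sub_le hopen hconn (hu m) (hu l) v
  have hc : CauchySeq fun m => lineProj (Φ (u m)) v := by
    refine Metric.cauchySeq_iff.2 fun ε hε => ?_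
    obtain ⟨N, hN⟩ := hcauchy (ε / (2 * ‖v‖)) (by positivity)
    refine ⟨N, fun m hm l hl => ?_⟩
    rw [dist_eq_norm]
    refine (hle l m).trans_lt ?_
    have := hN l hl m hm
    rw [lt_div_iff₀ (by positivity)] at this
    linarith
  obtain ⟨ω, hω⟩ := cauchySeq_tendsto_of_complete hc
  refine ⟨v, ω, ?_, hω, ?_⟩
  · rintro rfl
    have h1 : ∀ m ≥ K, ‖v‖ / 2 ≤ ‖lineProj (Φ (u m)) v‖ := by
      intro m hm
      have h2 := hle K m
      rw [lineProj_self] at h2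
      have h3 := hK K le_rfl m hm
      have h4 := norm_sub_norm_le v (lineProj (Φ (u m)) v)
      rw [norm_sub_rev] at h4
      nlinarith
    have h5 := ge_of_tendsto hω.norm (eventually_atTop.2 ⟨K, h1⟩)
    rw [norm_zero] at h5
    linarith
  · have h6 : Tendsto (fun m => lineProj (Φ (u m)) (ω - lineProj (Φ (u m)) v)) atTop (𝓝 0) := by
      refine squeeze_zero_norm (fun m => norm_lineProj_le _ _) ?_
      simpa using (hω.const_sub ω).norm
    have h7 := h6.add hω
    simpa only [lineProj_sub, lineProj_lineProj, sub_add_cancel, zero_add] using h7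

variable [CompleteSpace H]

/-- An interior Euclidean limit point is a T̃-limit of the whole Cauchy sequence. A boundary one
would make the quotient for a decomposition of the limiting `ω` tend to the Gram determinant itself.
-/
theorem IsKernelModel.tildeComplete (hk : IsKernelModel Ω k) (hopen : IsOpen Ω)
    (hconn : IsConnected Ω) (hbdd : Bornology.IsBounded Ω) (hW : IsWedge W)
    (hcrit : ∀ f : Fin (n + 1) → (Fin n → ℂ) → ℂ, (∀ j, IsL2Holomorphic Ω (f j)) →
      LinearIndependent ℂ (fun j => Ω.domRestrict (f j)) →
      ∀ z₀ ∈ frontier Ω, ∀ z : ℕ → Fin n → ℂ, (∀ s, z s ∈ Ω) → Tendsto z atTop (𝓝 z₀) →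
        ∃ φ : ℕ → ℕ, StrictMono φ ∧ ∃ L : ℝ,
          Tendsto (fun k => ‖(jetMatrix f (z (φ k))).det‖ ^ 2 /
            (kernelDiag Ω (z (φ k)) ^ (n + 1) * bergmanDet Ω (z (φ k)))) atTop (𝓝 L) ∧
          L < gramDet Ω f) :
    TildeComplete Ω := by
  intro u hu hcauchy
  have hΦ := hk.isFubiniStudyMap hopen hbdd hW
  obtain ⟨p, hp, φ, hφ, hlim⟩ := tendsto_subseq_of_bounded hbdd hu
  by_cases hpΩ : p ∈ Ω
  · refine ⟨p, hpΩ, Metric.tendsto_atTop.2 fun ε hε => ?_⟩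
    obtain ⟨N, hN⟩ := hcauchy (ε / 2) (half_pos hε)
    have h1 := ((hΦ.tendsto_tildeDist hopen hpΩ).comp hlim).eventually_lt_const (half_pos hε)
    obtain ⟨m, hm, hmN⟩ := (h1.and (eventually_ge_atTop N)).exists
    refine ⟨N, fun l hl => ?_⟩
    rw [Real.dist_0_eq_abs, abs_of_nonneg tildeDist_nonneg]
    have h2 := hΦ.tildeDist_triangle hopen hconn (hu l) (hu (φ m)) hpΩ
    have h3 := hN l hl (φ m) (hmN.trans (hφ.id_le m))
    simp only [Function.comp_apply] at hm
    linarith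
  exfalso
  obtain ⟨v, ω, hω0, hω, hωω⟩ := hΦ.exists_tendsto_lineProj hopen hconn hu hcauchy
  obtain ⟨g, hg⟩ : ∃ g, W g = ω := by
    -- The projected vector is a multiple of a wedge, hence a wedge after scaling slot `0`.
    refine hW.exists_apply_eq_of_tendsto (h := fun m => Function.update (kernelJet k (u m)) 0
      ((inner ℂ (W (kernelJet k (u m))) v / inner ℂ (W (kernelJet k (u m)))
        (W (kernelJet k (u m)))) • kernelJet k (u m) 0)) ?_ hω0
    simpa only [W.map_update_smul, Function.update_eq_self, lineProj] using hω
  set f : Fin (n + 1) → (Fin n → ℂ) → ℂ := fun j w => inner ℂ (k w) (g j)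
  have hf : ∀ j, IsL2Holomorphic Ω (f j) := fun j => hk.isL2Holomorphic (g j)
  have hfi : LinearIndependent ℂ fun j => Ω.domRestrict (f j) := by
    have hgi := hW.linearIndependent (hg.symm ▸ hω0)
    rw [Fintype.linearIndependent_iff] at hgi ⊢
    intro c hc
    -- A combination of the `g j` whose function vanishes on `Ω` has L² norm zero, so it is zero in
    -- the model.
    refine hgi c (inner_self_eq_zero (𝕜 := ℂ).1 ?_)
    rw [← hk.l2Inner_eq]
    have : EqOn (fun z => inner ℂ (k z) (∑ j, c j • g j)) (fun _ => 0) Ω := by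
      intro w hw
      have := congrFun hc ⟨w, hw⟩
      simpa [f, inner_sum, inner_smul_right, Finset.sum_apply] using this
    rw [l2Inner_congr hopen this this]
    simp [l2Inner]
  have hfr : p ∈ frontier Ω := by
    rw [frontier, hopen.interior_eq]
    exact ⟨hp, hpΩ⟩
  obtain ⟨ψ, hψ, L, hL, hlt⟩ := hcrit f hf hfi p hfr (u ∘ φ) (fun s => hu _) hlim
  have hgram : gramDet Ω f = ‖ω‖ ^ 2 := by
    have h1 := hW.norm_sq g
    rw [hg] at h1
    have h2 : (Matrix.of fun i j => l2Inner Ω (f j) (f i)) =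
        Matrix.of fun a b => inner ℂ (g a) (g b) := by
      ext i j
      exact hk.l2Inner_eq _ _
    rw [gramDet, h2, ← h1, Complex.ofReal_re]
  have hratio : ∀ m, ‖(jetMatrix f (u m)).det‖ ^ 2 /
      (kernelDiag Ω (u m) ^ (n + 1) * bergmanDet Ω (u m)) =
      ‖lineProj (W (kernelJet k (u m))) ω‖ ^ 2 := by
    intro m
    rw [hk.det_bergmanMetric hopen hbdd hW (hu m), norm_lineProj_sq,
      hk.det_jetMatrix hopen hW (hu m) (f := f) (g := g) (fun j w _ => rfl), hg]
  have hL2 : Tendsto (fun m => ‖lineProj (W (kernelJet k (u (φ (ψ m))))) ω‖ ^ 2) atTop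
      (𝓝 (‖ω‖ ^ 2)) :=
    ((hωω.comp (hφ.comp hψ).tendsto_atTop).norm.pow 2)
  simp only [Function.comp_apply, hratio] at hL
  rw [hgram, tendsto_nhds_unique hL hL2] at hlt
  exact lt_irrefl _ hlt

end Completeness

end BergmanRicci

end

theorem theorem2 (n : ℕ) (Ω : Set (Fin n → ℂ)) (hopen : IsOpen Ω) (hconn : IsConnected Ω)
    (hbdd : Bornology.IsBounded Ω)
    (hcrit : ∀ f : Fin (n + 1) → (Fin n → ℂ) → ℂ,
      (∀ j, BergmanRicci.IsL2Holomorphic Ω (f j)) →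
      LinearIndependent ℂ (fun j => Ω.domRestrict (f j)) →
      ∀ z₀ ∈ frontier Ω, ∀ z : ℕ → Fin n → ℂ, (∀ s, z s ∈ Ω) → Tendsto z atTop (𝓝 z₀) →
        ∃ φ : ℕ → ℕ, StrictMono φ ∧ ∃ L : ℝ,
          Tendsto (fun k => ‖(BergmanRicci.jetMatrix f (z (φ k))).det‖ ^ 2 /
            (BergmanRicci.kernelDiag Ω (z (φ k)) ^ (n + 1) *
              BergmanRicci.bergmanDet Ω (z (φ k)))) atTop (𝓝 L) ∧
          L < BergmanRicci.gramDet Ω f) :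
    BergmanRicci.TildeComplete Ω := by
  have := BergmanRicci.isFiniteMeasure_restrict hbdd
  obtain ⟨_, k, hk⟩ := BergmanRicci.exists_isKernelModel hopen hbdd
  -- The inclusion of the Bergman space into L² preserves inner products, so the restricted map
  -- still realizes the wedge product.
  let W := (BergmanRicci.lpWedge (volume.restrict Ω) (N := n + 1)).compContinuousLinearMap
    fun _ => (BergmanRicci.bergmanSpace Ω).subtypeL
  have hW : BergmanRicci.IsWedge W := fun f g => BergmanRicci.isWedge_lpWedge _ _ _
  exact hk.tildeComplete hopen hconn hbdd hW hcrit
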